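/- Let $F$ be a field of characteristic different from $2$ and $3$. **Composition algebras.** Besides $C=F$ (with $n(x)=x^2$), consider the split composition algebras: the binarions $\mathbb B=F\times F$ (diagonal $2\times2$ matrices, $n(a,d)=ad$), the quaternions $\mathbb H=M_2(F)$ with $n=\det$, and the octonions $\mathbb O=\mathbb H\oplus\mathbb H v$ with $(a+bv)(c+dv)=(ac-\bar d b)+(da+b\bar c)v$ and $n(a+bv)=\det a+\det b$, where $\bar a$ is the adjugate of $a\in M_2(F)$. In each of them put $n(x,y)=n(x+y)-n(x)-n(y)$, $t(x)=n(x,1)$, $\bar x=t(x)1-x$. **The cubic Jordan algebra.** $\mathfrak J=H_3(C)$ is the space of Hermitian matrices $$A=\begin{pmatrix}a&z&\bar y\\ \bar z&b&x\\ y&\bar x&c\end{pmatrix},\qquad a,b,c\in F,\ x,y,z\in C,$$ with cubic norm $N(A)=abc-a\,n(x)-b\,n(y)-c\,n(z)+t((xy)z)$, trace bilinear form $(A,A')=aa'+bb'+cc'+n(x,x')+n(y,y')+n(z,z')$, and sharp map $A\mapsto A^\#$, where $A^\#$ is the Hermitian matrix with diagonal entries $bc-n(x),\ ac-n(y),\ ab-n(z)$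 and with $\bar z\bar y-ax,\ \bar x\bar z-by,\ \bar y\bar x-cz$ in place of $x,y,z$. **The Freudenthal construction.** $M=M(\mathfrak J)=F\oplus F\oplus\mathfrak J\oplus\mathfrak J$. For $x=(\alpha,\beta,A,B)$ and $y=(\gamma,\delta,C,D)$ in $M$ put $$\{x,y\}=\alpha\delta-\beta\gamma+(A,D)-(B,C),$$ $$q(x)=8(A^\#,B^\#)-8\alpha N(A)-8\beta N(B)-2\bigl((A,B)-\alpha\beta\bigr)^2 .$$ $G=G(M)$ is the group of all invertible $F$-linear transformations $\sigma$ of $M$ with $\{\sigma x,\sigma y\}=\{x,y\}$ and $q(\sigma x)=q(x)$ for all $x,y\in M$. Let $q(x,y,z,w)$ be the symmetric four-linear form with $q(x,x,x,x)=q(x)$, and let $T(x,y,z)\in M$ be the unique element with $\{T(x,y,z),w\}=q(x,y,z,w)$ for all $w\in M$. **Rank.** The rank of $x\in M$ is the integer between $0$ and $4$ determined by: $\operatorname{rank}x=4$ iff $q(x)\ne0$; $\operatorname{rank}x\le3$ iff $q(x)=0$; $\operatorname{rank}x\le2$ iff $T(x,x,x)=0$; $\operatorname{rank}x\le1$ iff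 $3T(x,x,y)+\{x,y\}x=0$ for all $y\in M$; $\operatorname{rank}x=0$ iff $x=0$. **Theorem.** (i) Let $C$ be $\mathbb B$, $\mathbb H$ or $\mathbb O$ over $F$, and let $(G,M)$ be obtained from $\mathfrak J=H_3(C)$ as above. Then: - $q$ (the norm) is a $G$-invariant quartic form on $M$; - for $r=1,2,3$ the set of elements of rank $r$ in $M$ is a single (non-empty) $G$-orbit; - for every $k\in F$, $k\neq0$, the set of elements of rank $4$ and norm $q(x)=k$ is a single (non-empty) $G$-orbit; - all these orbits are distinct from each other and from $\{0\}$, and their union with $\{0\}$ is the whole of $M$. (ii) If in addition every element of $F$ is a square, then the same holds for the pair $(G,M)$ obtained from $\mathfrak J=H_3(F)$. -/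

import Mathlib

namespace Freudenthal

/-! ### Composition algebras -/

/-- A composition algebra over `F`: a unital, not necessarily associative algebra with a
non-degenerate quadratic form which is multiplicative. -/
class CompositionAlgebra (F : Type*) (C : Type*) [Field F] [NonAssocRing C] [Module F C]
    [IsScalarTower F C C] [SMulCommClass F C C] where
  normForm : QuadraticForm F C
  normForm_mul : ∀ x y : C, normForm (x * y) = normForm x * normForm y
  polar_nondegenerate : ∀ x : C, (∀ y : C, QuadraticMap.polar normForm x y = 0) → x = 0

section Composition

variable (F : Type*) {C : Type*} [Field F] [NonAssocRing C] [Module F C]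
  [IsScalarTower F C C] [SMulCommClass F C C] [CompositionAlgebra F C]

/-- The norm `n(x)` in a composition algebra. -/
def nrm (x : C) : F := CompositionAlgebra.normForm (F := F) x

/-- The bilinear form `n(x, y) = n(x + y) - n(x) - n(y)`. -/
def nrm₂ : C →ₗ[F] C →ₗ[F] F := (CompositionAlgebra.normForm (F := F) (C := C)).polarBilin

/-- The trace `t(x) = n(x, 1)`. -/
def tr : C →ₗ[F] F := (nrm₂ F).flip 1

/-- The conjugation `x̄ = t(x) 1 - x`. -/
def conj : C →ₗ[F] C := (tr F).smulRight 1 - LinearMap.id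

end Composition

/-- The ground field as a one-dimensional composition algebra with `n(x) = x²`. -/
noncomputable instance instField (F : Type*) [Field F] [NeZero (2 : F)] :
    CompositionAlgebra F F where
  normForm := QuadraticMap.sq
  normForm_mul x y := by simp only [QuadraticMap.sq_apply]; ring
  polar_nondegenerate x h := by
    have := h 1
    simp only [QuadraticMap.polar, QuadraticMap.sq_apply] at this
    have h2 : (2 : F) * x = 0 := by linear_combination this
    exact (mul_eq_zero.1 h2).resolve_left (NeZero.ne _)

/-- Split binarions: the diagonal `2 × 2` matrices `diag(a, d)`, written as pairs `(a, d)` with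
componentwise operations. -/
abbrev Binarion (F : Type*) := F × F

/-- The norm `a d` of the binarion `(a, d)`. -/
noncomputable def Binarion.normForm (F : Type*) [Field F] : QuadraticForm F (Binarion F) :=
  QuadraticMap.linMulLin (LinearMap.fst F F F) (LinearMap.snd F F F)

noncomputable instance instBinarion (F : Type*) [Field F] : CompositionAlgebra F (Binarion F) where
  normForm := Binarion.normForm F
  normForm_mul x y := by simp [Binarion.normForm]; ring
  polar_nondegenerate x h := by
    have h1 := h (1, 0)
    have h2 := h (0, 1)
    simp [QuadraticMap.polar, Binarion.normForm] at h1 h2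
    ext
    · simp; linear_combination h2
    · simp; linear_combination h1

/-- Split quaternions: the algebra of `2 × 2` matrices. -/
abbrev SplitQuaternion (F : Type*) := Matrix (Fin 2) (Fin 2) F

/-- The norm of a split quaternion is its determinant. -/
noncomputable def SplitQuaternion.normForm (F : Type*) [Field F] :
    QuadraticForm F (SplitQuaternion F) where
  toFun a := a.det
  toFun_smul r a := by
    simp only [Matrix.det_fin_two, Matrix.smul_apply, smul_eq_mul]; ring
  exists_companion' := by
    refine ⟨LinearMap.mk₂ F (fun a b => a 0 0 * b 1 1 + b 0 0 * a 1 1 - a 0 1 * b 1 0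
      - b 0 1 * a 1 0) ?_ ?_ ?_ ?_, ?_⟩ <;> intros <;>
      simp [Matrix.det_fin_two] <;> ring

noncomputable instance instSplitQuaternion (F : Type*) [Field F] :
    CompositionAlgebra F (SplitQuaternion F) where
  normForm := SplitQuaternion.normForm F
  normForm_mul x y := Matrix.det_mul x y
  polar_nondegenerate x h := by
    have h1 := h !![1, 0; 0, 0]
    have h2 := h !![0, 1; 0, 0]
    have h3 := h !![0, 0; 1, 0]
    have h4 := h !![0, 0; 0, 1]
    simp [QuadraticMap.polar, SplitQuaternion.normForm, Matrix.det_fin_two] at h1 h2 h3 h4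
    ext i j
    fin_cases i <;> fin_cases j <;> simp
    · linear_combination h4
    · linear_combination -h3
    · linear_combination -h2
    · linear_combination h1

/-- Split octonions `a + b v`, with `a`, `b` split quaternions, written as pairs `(a, b)`. -/
def SplitOctonion (F : Type*) := SplitQuaternion F × SplitQuaternion F

namespace SplitOctonion

variable {F : Type*} [Field F]

instance : AddCommGroup (SplitOctonion F) :=
  inferInstanceAs (AddCommGroup (SplitQuaternion F × SplitQuaternion F))

instance : Module F (SplitOctonion F) :=
  inferInstanceAs (Module F (SplitQuaternion F × SplitQuaternion F))

instance : Module.Finite F (SplitOctonion F) :=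
  inferInstanceAs (Module.Finite F (SplitQuaternion F × SplitQuaternion F))

/-- `(a + b v)(c + d v) = (a c - d̄ b) + (d a + b c̄) v`; the conjugation `ā` of `2 × 2` matrices is
the adjugate. -/
instance : Mul (SplitOctonion F) where
  mul x y := (x.1 * y.1 - y.2.adjugate * x.2, y.2 * x.1 + x.2 * y.1.adjugate)

instance : One (SplitOctonion F) where
  one := ((1 : SplitQuaternion F), (0 : SplitQuaternion F))

@[simp] theorem add_fst (x y : SplitOctonion F) : (x + y).1 = x.1 + y.1 := rfl
@[simp] theorem add_snd (x y : SplitOctonion F) : (x + y).2 = x.2 + y.2 := rfl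
@[simp] theorem smul_fst (r : F) (x : SplitOctonion F) : (r • x).1 = r • x.1 := rfl
@[simp] theorem smul_snd (r : F) (x : SplitOctonion F) : (r • x).2 = r • x.2 := rfl
@[simp] theorem zero_fst : (0 : SplitOctonion F).1 = 0 := rfl
@[simp] theorem zero_snd : (0 : SplitOctonion F).2 = 0 := rfl
@[simp] theorem one_fst : (1 : SplitOctonion F).1 = 1 := rfl
@[simp] theorem one_snd : (1 : SplitOctonion F).2 = 0 := rfl
@[simp] theorem mul_fst (x y : SplitOctonion F) :
    (x * y).1 = x.1 * y.1 - y.2.adjugate * x.2 := rfl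
@[simp] theorem mul_snd (x y : SplitOctonion F) :
    (x * y).2 = y.2 * x.1 + x.2 * y.1.adjugate := rfl


theorem ext' {x y : SplitOctonion F} (h1 : x.1 = y.1) (h2 : x.2 = y.2) : x = y := Prod.ext h1 h2

theorem adjugate_add' (a b : SplitQuaternion F) :
    (a + b).adjugate = a.adjugate + b.adjugate := by
  ext i j; fin_cases i <;> fin_cases j <;> simp [Matrix.adjugate_fin_two] <;> ring

theorem adjugate_smul' (r : F) (a : SplitQuaternion F) :
    (r • a).adjugate = r • a.adjugate := by
  ext i j; fin_cases i <;> fin_cases j <;> simp [Matrix.adjugate_fin_two]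

instance : NonAssocRing (SplitOctonion F) where
  left_distrib x y z := ext' (by simp [adjugate_add', mul_add, add_mul]; abel)
    (by simp [adjugate_add', mul_add, add_mul]; abel)
  right_distrib x y z := ext' (by simp [mul_add, add_mul]; abel)
    (by simp [mul_add, add_mul]; abel)
  zero_mul x := ext' (by simp) (by simp)
  mul_zero x := ext' (by simp) (by simp)
  one_mul x := ext' (by simp) (by simp)
  mul_one x := ext' (by simp) (by simp)

instance : IsScalarTower F (SplitOctonion F) (SplitOctonion F) where
  smul_assoc r x y := ext' (by simp [smul_sub]) (by simp [smul_add])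

instance : SMulCommClass F (SplitOctonion F) (SplitOctonion F) where
  smul_comm r x y := ext' (by simp [smul_sub, adjugate_smul'])
    (by simp [smul_add, adjugate_smul'])

/-- The norm `det a + det b` of the octonion `a + b v`. -/
noncomputable def normForm (F : Type*) [Field F] : QuadraticForm F (SplitOctonion F) :=
  (SplitQuaternion.normForm F).prod (SplitQuaternion.normForm F)

theorem normForm_eq (x : SplitOctonion F) : normForm F x = x.1.det + x.2.det := rfl

end SplitOctonion

noncomputable instance instSplitOctonion (F : Type*) [Field F] :
    CompositionAlgebra F (SplitOctonion F) where
  normForm := SplitOctonion.normForm F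
  normForm_mul x y := by
    simp only [SplitOctonion.normForm_eq, SplitOctonion.mul_fst, SplitOctonion.mul_snd,
      Matrix.det_fin_two, Matrix.adjugate_fin_two, Matrix.mul_apply, Matrix.sub_apply,
      Matrix.add_apply, Fin.sum_univ_two]
    simp
    ring
  polar_nondegenerate x h := by
    apply SplitOctonion.ext'
    · refine CompositionAlgebra.polar_nondegenerate (F := F) x.1 fun y => ?_
      have := h ((y, 0) : SplitQuaternion F × SplitQuaternion F)
      change (x.1 + y).det + (x.2 + 0).det - (x.1.det + x.2.det)
        - ((y : SplitQuaternion F).det + (0 : SplitQuaternion F).det) = 0 at this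
      change (x.1 + y).det - x.1.det - y.det = 0
      have hz : (0 : SplitQuaternion F).det = 0 := by simp
      simp only [add_zero, hz] at this
      linear_combination this
    · refine CompositionAlgebra.polar_nondegenerate (F := F) x.2 fun y => ?_
      have := h ((0, y) : SplitQuaternion F × SplitQuaternion F)
      change (x.1 + 0).det + (x.2 + y).det - (x.1.det + x.2.det)
        - ((0 : SplitQuaternion F).det + (y : SplitQuaternion F).det) = 0 at this
      change (x.2 + y).det - x.2.det - y.det = 0
      have hz : (0 : SplitQuaternion F).det = 0 := by simp
      simp only [add_zero, hz] at this
      linear_combination this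

/-! ### The cubic Jordan algebra of Hermitian matrices -/

/-- The space `H₃(C)`: the sextuple `(a, b, c, x, y, z)` stands for the Hermitian matrix with rows
`(a, z, ȳ)`, `(z̄, b, x)`, `(y, x̄, c)`, where `a`, `b`, `c` are scalars. -/
abbrev Herm₃ (F C : Type*) := F × F × F × C × C × C

namespace Herm₃

variable {F C : Type*} [Field F] [NonAssocRing C] [Module F C]
  [IsScalarTower F C C] [SMulCommClass F C C] [CompositionAlgebra F C]

/-- The cubic norm `N(A) = abc - a n(x) - b n(y) - c n(z) + t((xy)z)`. -/
def N : Herm₃ F C → F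
  | (a, b, c, x, y, z) =>
    a * b * c - a * nrm F x - b * nrm F y - c * nrm F z + tr F ((x * y) * z)

/-- The trace bilinear form, `(A, A') = tr (A A' + A' A) / 2`. -/
def form : Herm₃ F C → Herm₃ F C → F
  | (a, b, c, x, y, z), (a', b', c', x', y', z') =>
    a * a' + b * b' + c * c' + nrm₂ F x x' + nrm₂ F y y' + nrm₂ F z z'

/-- The sharp map `A ↦ A^#`, that is, the adjoint matrix. -/
def sharp : Herm₃ F C → Herm₃ F C
  | (a, b, c, x, y, z) =>
    (b * c - nrm F x, a * c - nrm F y, a * b - nrm F z,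
      conj F z * conj F y - a • x, conj F x * conj F z - b • y, conj F y * conj F x - c • z)

end Herm₃

/-! ### Quartic forms -/

/-- A quartic form: the restriction of a four-linear form to the diagonal. -/
def IsQuarticForm {F V : Type*} [Field F] [AddCommGroup V] [Module F V] (f : V → F) : Prop :=
  ∃ Φ : V →ₗ[F] V →ₗ[F] V →ₗ[F] V →ₗ[F] F, ∀ x, f x = Φ x x x x

/-- The full linearization of a quartic form `f`: the symmetric four-linear form with
`f(x, x, x, x) = f(x)`. -/
def linearize₄ {F V : Type*} [Field F] [AddCommGroup V] (f : V → F) (x y z w : V) : F :=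
  (24 : F)⁻¹ * (f (x + y + z + w)
    - f (x + y + z) - f (x + y + w) - f (x + z + w) - f (y + z + w)
    + f (x + y) + f (x + z) + f (x + w) + f (y + z) + f (y + w) + f (z + w)
    - f x - f y - f z - f w)

section Quartic

variable {F V W W' : Type*} [Field F] [AddCommGroup V] [Module F V] [AddCommGroup W] [Module F W]
  [AddCommGroup W'] [Module F W']

/-- A quadratic map, as the restriction of a bilinear map to the diagonal. -/
def IsQuadratic (u : V → W) : Prop := ∃ B : V →ₗ[F] V →ₗ[F] W, ∀ x, u x = B x x

theorem IsQuadratic.sub {u v : V → W} (hu : IsQuadratic (F := F) u) (hv : IsQuadratic (F := F) v) :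
    IsQuadratic (F := F) (fun x => u x - v x) := by
  obtain ⟨B, hB⟩ := hu
  obtain ⟨B', hB'⟩ := hv
  exact ⟨B - B', fun x => by simp [hB, hB']⟩

theorem IsQuadratic.add {u v : V → W} (hu : IsQuadratic (F := F) u) (hv : IsQuadratic (F := F) v) :
    IsQuadratic (F := F) (fun x => u x + v x) := by
  obtain ⟨B, hB⟩ := hu
  obtain ⟨B', hB'⟩ := hv
  exact ⟨B + B', fun x => by simp [hB, hB']⟩

theorem IsQuadratic.bilin {U U' : Type*} [AddCommGroup U] [Module F U] [AddCommGroup U']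
    [Module F U'] (β : U →ₗ[F] U' →ₗ[F] W) (l : V →ₗ[F] U) (m : V →ₗ[F] U') :
    IsQuadratic (F := F) (fun x => β (l x) (m x)) :=
  ⟨β.compl₁₂ l m, fun x => by simp⟩

theorem IsQuarticForm.bilin {u : V → W} {v : V → W'} (hu : IsQuadratic (F := F) u)
    (hv : IsQuadratic (F := F) v) (β : W →ₗ[F] W' →ₗ[F] F) :
    IsQuarticForm (fun x => β (u x) (v x)) := by
  obtain ⟨B, hB⟩ := hu
  obtain ⟨B', hB'⟩ := hv
  refine ⟨LinearMap.mk₂ F (fun x y => B'.compr₂ (β (B x y))) ?_ ?_ ?_ ?_, fun x => ?_⟩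
  · intros; ext; simp
  · intros; ext; simp
  · intros; ext; simp
  · intros; ext; simp
  · simp [hB, hB']

theorem IsQuarticForm.add {f g : V → F} (hf : IsQuarticForm f) (hg : IsQuarticForm g) :
    IsQuarticForm (fun x => f x + g x) := by
  obtain ⟨B, hB⟩ := hf
  obtain ⟨B', hB'⟩ := hg
  exact ⟨B + B', fun x => by simp [hB, hB']⟩

theorem IsQuarticForm.smul {f : V → F} (hf : IsQuarticForm f) (r : F) :
    IsQuarticForm (fun x => r * f x) := by
  obtain ⟨B, hB⟩ := hf
  exact ⟨r • B, fun x => by simp [hB]⟩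

theorem IsQuarticForm.linearize₄_linear {f : V → F} (hf : IsQuarticForm f) (x y z : V) :
    ∃ φ : Module.Dual F V, ∀ w, linearize₄ f x y z w = φ w := by
  obtain ⟨Φ, h⟩ := hf
  refine ⟨(24 : F)⁻¹ • (
    Φ x y z + Φ x z y + Φ y x z + Φ y z x + Φ z x y + Φ z y x +
    (Φ x y).flip z + (Φ x z).flip y + (Φ y x).flip z + (Φ y z).flip x + (Φ z x).flip y
      + (Φ z y).flip x +
    ((Φ x).flip y).flip z + ((Φ x).flip z).flip y + ((Φ y).flip x).flip z
      + ((Φ y).flip z).flip x + ((Φ z).flip x).flip y + ((Φ z).flip y).flip x +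
    ((Φ.flip x).flip y).flip z + ((Φ.flip x).flip z).flip y + ((Φ.flip y).flip x).flip z
      + ((Φ.flip y).flip z).flip x + ((Φ.flip z).flip x).flip y
      + ((Φ.flip z).flip y).flip x), fun w => ?_⟩
  simp only [linearize₄, h, map_add, LinearMap.add_apply, LinearMap.smul_apply,
    LinearMap.flip_apply, smul_eq_mul]
  ring

theorem IsQuarticForm.linearize₄_self [NeZero (2 : F)] [NeZero (3 : F)] {f : V → F}
    (hf : IsQuarticForm f) (x : V) : linearize₄ f x x x x = f x := by
  obtain ⟨Φ, h⟩ := hf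
  have h24 : (24 : F) ≠ 0 := by
    have h2 : (2 : F) ≠ 0 := NeZero.ne _
    have h3 : (3 : F) ≠ 0 := NeZero.ne _
    have : (24 : F) = 2 * 2 * 2 * 3 := by norm_num
    rw [this]
    simp [h2, h3]
  rw [linearize₄, inv_mul_eq_iff_eq_mul₀ h24]
  simp only [h, map_add, LinearMap.add_apply]
  ring

end Quartic

/-! ### The Freudenthal construction -/

/-- The module `M(J) = F ⊕ F ⊕ J ⊕ J` for `J = H₃(C)`, with elements `(α, β, A, B)`. -/
abbrev FModule (F C : Type*) := F × F × Herm₃ F C × Herm₃ F C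

section Module

variable {F C : Type*} [Field F] [NonAssocRing C] [Module F C]
  [IsScalarTower F C C] [SMulCommClass F C C] [CompositionAlgebra F C]

open Herm₃

/-- The skew-symmetric form `{x, y} = αδ - βγ + (A, D) - (B, C)`. -/
def symp : FModule F C → FModule F C → F
  | (α, β, A, B), (γ, δ, C, D) => α * δ - β * γ + form A D - form B C

/-- The quartic norm
`q(x) = 8 (A^#, B^#) - 8 α N(A) - 8 β N(B) - 2 ((A, B) - αβ)²`. -/
def q : FModule F C → F
  | (α, β, A, B) =>
    8 * form (sharp A) (sharp B) - 8 * α * N A - 8 * β * N B - 2 * (form A B - α * β) ^ 2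

/-- The group `G(M)` of invertible linear transformations of `M(J)` preserving the skew-symmetric
form and the quartic norm. -/
def G (F C : Type*) [Field F] [NonAssocRing C] [Module F C]
    [IsScalarTower F C C] [SMulCommClass F C C] [CompositionAlgebra F C] :
    Subgroup (FModule F C ≃ₗ[F] FModule F C) where
  carrier := {σ | (∀ x y, symp (σ x) (σ y) = symp x y) ∧ ∀ x, q (σ x) = q x}
  mul_mem' {σ τ} hσ hτ := ⟨fun x y => by
    rw [LinearEquiv.mul_apply, LinearEquiv.mul_apply, hσ.1, hτ.1], fun x => by
    rw [LinearEquiv.mul_apply, hσ.2, hτ.2]⟩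
  one_mem' := ⟨fun _ _ => rfl, fun _ => rfl⟩
  inv_mem' {σ} hσ := ⟨fun x y => by
    rw [← hσ.1 (σ⁻¹ x), ← LinearEquiv.mul_apply, ← LinearEquiv.mul_apply, mul_inv_cancel]; rfl,
    fun x => by rw [← hσ.2 (σ⁻¹ x), ← LinearEquiv.mul_apply, mul_inv_cancel]; rfl⟩

theorem quadratic_nrm [NeZero (2 : F)] {V : Type*} [AddCommGroup V] [Module F V] (l : V →ₗ[F] C) :
    IsQuadratic (F := F) (fun v => nrm F (l v)) := by
  refine ⟨(2 : F)⁻¹ • (nrm₂ F).compl₁₂ l l, fun v => ?_⟩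
  simp only [nrm₂, nrm, LinearMap.smul_apply, LinearMap.compl₁₂_apply,
    QuadraticMap.polarBilin_apply_apply, QuadraticMap.polar_self, smul_eq_mul]
  rw [nsmul_eq_mul, Nat.cast_ofNat, inv_mul_cancel_left₀ (NeZero.ne _)]

theorem q_isQuarticForm [NeZero (2 : F)] : IsQuarticForm (q : FModule F C → F) := by
  let α : FModule F C →ₗ[F] F := LinearMap.fst _ _ _
  let β : FModule F C →ₗ[F] F := LinearMap.fst _ _ _ ∘ₗ LinearMap.snd _ _ _
  let A : FModule F C →ₗ[F] Herm₃ F C :=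
    LinearMap.fst _ _ _ ∘ₗ LinearMap.snd _ _ _ ∘ₗ LinearMap.snd _ _ _
  let B : FModule F C →ₗ[F] Herm₃ F C :=
    LinearMap.snd _ _ _ ∘ₗ LinearMap.snd _ _ _ ∘ₗ LinearMap.snd _ _ _
  let a : Herm₃ F C →ₗ[F] F := LinearMap.fst _ _ _
  let b : Herm₃ F C →ₗ[F] F := LinearMap.fst _ _ _ ∘ₗ LinearMap.snd _ _ _
  let c : Herm₃ F C →ₗ[F] F := LinearMap.fst _ _ _ ∘ₗ LinearMap.snd _ _ _ ∘ₗ LinearMap.snd _ _ _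
  let x : Herm₃ F C →ₗ[F] C := LinearMap.fst _ _ _ ∘ₗ LinearMap.snd _ _ _ ∘ₗ
    LinearMap.snd _ _ _ ∘ₗ LinearMap.snd _ _ _
  let y : Herm₃ F C →ₗ[F] C := LinearMap.fst _ _ _ ∘ₗ LinearMap.snd _ _ _ ∘ₗ
    LinearMap.snd _ _ _ ∘ₗ LinearMap.snd _ _ _ ∘ₗ LinearMap.snd _ _ _
  let z : Herm₃ F C →ₗ[F] C := LinearMap.snd _ _ _ ∘ₗ LinearMap.snd _ _ _ ∘ₗ
    LinearMap.snd _ _ _ ∘ₗ LinearMap.snd _ _ _ ∘ₗ LinearMap.snd _ _ _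
  have mulQ (l m : FModule F C →ₗ[F] F) : IsQuadratic (F := F) (fun v => l v * m v) :=
    IsQuadratic.bilin (LinearMap.mul F F) l m
  have mulC (l m : FModule F C →ₗ[F] C) : IsQuadratic (F := F) (fun v => l v * m v) :=
    IsQuadratic.bilin (LinearMap.mul F C) l m
  have smulC (l : FModule F C →ₗ[F] F) (m : FModule F C →ₗ[F] C) :
      IsQuadratic (F := F) (fun v => l v • m v) :=
    IsQuadratic.bilin (LinearMap.lsmul F C) l m
  have mul4 {u v : FModule F C → F} (hu : IsQuadratic (F := F) u) (hv : IsQuadratic (F := F) v) :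
      IsQuarticForm (fun w => u w * v w) :=
    IsQuarticForm.bilin hu hv (LinearMap.mul F F)
  have diag (l m : Herm₃ F C →ₗ[F] F) (n : Herm₃ F C →ₗ[F] C) (P : FModule F C →ₗ[F] Herm₃ F C) :
      IsQuadratic (F := F) (fun v => l (P v) * m (P v) - nrm F (n (P v))) :=
    (mulQ (l ∘ₗ P) (m ∘ₗ P)).sub (quadratic_nrm (n ∘ₗ P))
  have off (l m n : Herm₃ F C →ₗ[F] C) (p : Herm₃ F C →ₗ[F] F) (P : FModule F C →ₗ[F] Herm₃ F C) :
      IsQuadratic (F := F) (fun v => conj F (l (P v)) * conj F (m (P v)) - p (P v) • n (P v)) :=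
    (mulC (conj F ∘ₗ l ∘ₗ P) (conj F ∘ₗ m ∘ₗ P)).sub (smulC (p ∘ₗ P) (n ∘ₗ P))
  have two (l m n : Herm₃ F C →ₗ[F] C) (p : Herm₃ F C →ₗ[F] F) :
      IsQuarticForm (fun v : FModule F C => nrm₂ F
        (conj F (l (A v)) * conj F (m (A v)) - p (A v) • n (A v))
        (conj F (l (B v)) * conj F (m (B v)) - p (B v) • n (B v))) :=
    IsQuarticForm.bilin (off l m n p A) (off l m n p B) (nrm₂ F)
  have cubic (l : FModule F C →ₗ[F] F) (P : FModule F C →ₗ[F] Herm₃ F C) :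
      IsQuarticForm (fun v => l v * N (P v)) := by
    have h := ((((mul4 (mulQ l (a ∘ₗ P)) (mulQ (b ∘ₗ P) (c ∘ₗ P))).add
      ((mul4 (mulQ l (a ∘ₗ P)) (quadratic_nrm (x ∘ₗ P))).smul (-1))).add
      ((mul4 (mulQ l (b ∘ₗ P)) (quadratic_nrm (y ∘ₗ P))).smul (-1))).add
      ((mul4 (mulQ l (c ∘ₗ P)) (quadratic_nrm (z ∘ₗ P))).smul (-1))).add
      (IsQuarticForm.bilin (mulC (x ∘ₗ P) (y ∘ₗ P)) (smulC l (z ∘ₗ P))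
        ((LinearMap.mul F C).compr₂ (tr F)))
    obtain ⟨Φ, hΦ⟩ := h
    refine ⟨Φ, fun v => ?_⟩
    rw [← hΦ]
    change l v * (a (P v) * b (P v) * c (P v) - a (P v) * nrm F (x (P v)) -
      b (P v) * nrm F (y (P v)) - c (P v) * nrm F (z (P v)) +
      tr F ((x (P v) * y (P v)) * z (P v))) = _
    simp only [LinearMap.comp_apply, LinearMap.compr₂_apply, LinearMap.mul_apply',
      mul_smul_comm, map_smul, smul_eq_mul]
    ring
  have formQ : IsQuadratic (F := F) (fun v : FModule F C => form (A v) (B v) - α v * β v) :=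
    ((((((mulQ (a ∘ₗ A) (a ∘ₗ B)).add (mulQ (b ∘ₗ A) (b ∘ₗ B))).add
      (mulQ (c ∘ₗ A) (c ∘ₗ B))).add (IsQuadratic.bilin (nrm₂ F) (x ∘ₗ A) (x ∘ₗ B))).add
      (IsQuadratic.bilin (nrm₂ F) (y ∘ₗ A) (y ∘ₗ B))).add
      (IsQuadratic.bilin (nrm₂ F) (z ∘ₗ A) (z ∘ₗ B))).sub (mulQ α β)
  have h := (((((((((mul4 (diag b c x A) (diag b c x B)).add
    (mul4 (diag a c y A) (diag a c y B))).add (mul4 (diag a b z A) (diag a b z B))).add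
    (two z y x a)).add (two x z y b)).add (two y x z c)).smul 8).add
    ((cubic α A).smul (-8))).add ((cubic β B).smul (-8))).add
    ((mul4 formQ formQ).smul (-2))
  obtain ⟨Φ, hΦ⟩ := h
  refine ⟨Φ, fun v => ?_⟩
  rw [← hΦ]
  change 8 * form (sharp (A v)) (sharp (B v)) - 8 * α v * N (A v) - 8 * β v * N (B v)
    - 2 * (form (A v) (B v) - α v * β v) ^ 2 = _
  have hs : form (sharp (A v)) (sharp (B v)) =
      (b (A v) * c (A v) - nrm F (x (A v))) * (b (B v) * c (B v) - nrm F (x (B v)))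
      + (a (A v) * c (A v) - nrm F (y (A v))) * (a (B v) * c (B v) - nrm F (y (B v)))
      + (a (A v) * b (A v) - nrm F (z (A v))) * (a (B v) * b (B v) - nrm F (z (B v)))
      + nrm₂ F (conj F (z (A v)) * conj F (y (A v)) - a (A v) • x (A v))
          (conj F (z (B v)) * conj F (y (B v)) - a (B v) • x (B v))
      + nrm₂ F (conj F (x (A v)) * conj F (z (A v)) - b (A v) • y (A v))
          (conj F (x (B v)) * conj F (z (B v)) - b (B v) • y (B v))
      + nrm₂ F (conj F (y (A v)) * conj F (x (A v)) - c (A v) • z (A v))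
          (conj F (y (B v)) * conj F (x (B v)) - c (B v) • z (B v)) := rfl
  rw [hs]
  ring

/-- The skew-symmetric form as a bilinear map. -/
def sympBilin : FModule F C →ₗ[F] FModule F C →ₗ[F] F :=
  LinearMap.mk₂ F symp
    (by rintro ⟨α, β, ⟨a, b, c, x, y, z⟩, ⟨a', b', c', x', y', z'⟩⟩
          ⟨α₁, β₁, ⟨a₁, b₁, c₁, x₁, y₁, z₁⟩, ⟨a₁', b₁', c₁', x₁', y₁', z₁'⟩⟩
          ⟨α₂, β₂, ⟨a₂, b₂, c₂, x₂, y₂, z₂⟩, ⟨a₂', b₂', c₂', x₂', y₂', z₂'⟩⟩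
        simp only [symp, form, Prod.mk_add_mk, map_add, LinearMap.add_apply]; ring)
    (by rintro r ⟨α, β, ⟨a, b, c, x, y, z⟩, ⟨a', b', c', x', y', z'⟩⟩
          ⟨α₁, β₁, ⟨a₁, b₁, c₁, x₁, y₁, z₁⟩, ⟨a₁', b₁', c₁', x₁', y₁', z₁'⟩⟩
        simp only [symp, form, Prod.smul_mk, map_smul, LinearMap.smul_apply, smul_eq_mul]; ring)
    (by rintro ⟨α, β, ⟨a, b, c, x, y, z⟩, ⟨a', b', c', x', y', z'⟩⟩
          ⟨α₁, β₁, ⟨a₁, b₁, c₁, x₁, y₁, z₁⟩, ⟨a₁', b₁', c₁', x₁', y₁', z₁'⟩⟩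
          ⟨α₂, β₂, ⟨a₂, b₂, c₂, x₂, y₂, z₂⟩, ⟨a₂', b₂', c₂', x₂', y₂', z₂'⟩⟩
        simp only [symp, form, Prod.mk_add_mk, map_add, LinearMap.add_apply]; ring)
    (by rintro r ⟨α, β, ⟨a, b, c, x, y, z⟩, ⟨a', b', c', x', y', z'⟩⟩
          ⟨α₁, β₁, ⟨a₁, b₁, c₁, x₁, y₁, z₁⟩, ⟨a₁', b₁', c₁', x₁', y₁', z₁'⟩⟩
        simp only [symp, form, Prod.smul_mk, map_smul, LinearMap.smul_apply, smul_eq_mul]; ring)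

theorem form_nondegenerate (A : Herm₃ F C) (h : ∀ B, form A B = 0) : A = 0 := by
  obtain ⟨a, b, c, x, y, z⟩ := A
  have ha := h (1, 0, 0, 0, 0, 0)
  have hb := h (0, 1, 0, 0, 0, 0)
  have hc := h (0, 0, 1, 0, 0, 0)
  have hx := fun w => h (0, 0, 0, w, 0, 0)
  have hy := fun w => h (0, 0, 0, 0, w, 0)
  have hz := fun w => h (0, 0, 0, 0, 0, w)
  simp [form] at ha hb hc hx hy hz
  simp [ha, hb, hc, CompositionAlgebra.polar_nondegenerate (F := F) x hx,
    CompositionAlgebra.polar_nondegenerate (F := F) y hy,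
    CompositionAlgebra.polar_nondegenerate (F := F) z hz]

theorem sympBilin_injective :
    Function.Injective (sympBilin : FModule F C →ₗ[F] FModule F C →ₗ[F] F) := by
  rw [injective_iff_map_eq_zero]
  rintro ⟨α, β, A, B⟩ h
  have h' : ∀ y, symp (α, β, A, B) y = 0 := fun y => LinearMap.congr_fun h y
  have form_zero : ∀ A : Herm₃ F C, form A 0 = 0 := by
    rintro ⟨a, b, c, x, y, z⟩
    change form _ (0, 0, 0, 0, 0, 0) = 0
    simp [form]
  have h1 := h' (0, 1, 0, 0)
  have h2 := h' (1, 0, 0, 0)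
  have h3 := form_nondegenerate A fun D => by
    simpa [symp, form_zero] using h' (0, 0, 0, D)
  have h4 := form_nondegenerate B fun D => by
    simpa [symp, form_zero] using h' (0, 0, D, 0)
  simp [symp, form_zero] at h1 h2
  simp [h1, h2, h3, h4]

theorem existsUnique_T [NeZero (2 : F)] [Module.Finite F C] (x y z : FModule F C) :
    ∃! t : FModule F C, ∀ w, symp t w = linearize₄ q x y z w := by
  obtain ⟨φ, hφ⟩ := (q_isQuarticForm (F := F) (C := C)).linearize₄_linear x y z
  have hsurj : Function.Surjective (sympBilin : FModule F C →ₗ[F] Module.Dual F (FModule F C)) :=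
    (LinearMap.injective_iff_surjective_of_finrank_eq_finrank
      Subspace.dual_finrank_eq.symm).1 sympBilin_injective
  obtain ⟨t, ht⟩ := hsurj φ
  refine ⟨t, fun w => ?_, fun s hs => sympBilin_injective ?_⟩
  · rw [hφ, ← ht]; rfl
  · rw [ht]; exact LinearMap.ext fun w => (hs w).trans (hφ w)

/-- The trilinear operator `T`: the element `T(x, y, z)` is the unique one such that
`{T(x, y, z), w} = q(x, y, z, w)` for all `w`. -/
noncomputable def T [NeZero (2 : F)] [Module.Finite F C] (x y z : FModule F C) : FModule F C :=
  (existsUnique_T x y z).choose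

theorem symp_T [NeZero (2 : F)] [Module.Finite F C] (x y z w : FModule F C) :
    symp (T x y z) w = linearize₄ q x y z w :=
  (existsUnique_T x y z).choose_spec.1 w

open Classical in
/-- The rank of an element of `M(J)`; see `rank_conditions` for the defining relations. -/
noncomputable def rank [NeZero (2 : F)] [Module.Finite F C] (x : FModule F C) : ℕ :=
  if x = 0 then 0
  else if ∀ y, (3 : F) • T x x y + symp x y • x = 0 then 1
  else if T x x x = 0 then 2
  else if q x = 0 then 3
  else 4

theorem rank_conditions [NeZero (2 : F)] [NeZero (3 : F)] [Module.Finite F C] (x : FModule F C) :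
    (rank x = 4 ↔ q x ≠ 0) ∧ (rank x ≤ 3 ↔ q x = 0) ∧ (rank x ≤ 2 ↔ T x x x = 0) ∧
    (rank x ≤ 1 ↔ ∀ y, (3 : F) • T x x y + symp x y • x = 0) ∧ (rank x = 0 ↔ x = 0) := by
  have h3 : (3 : F) ≠ 0 := NeZero.ne _
  have hself : ∀ y : FModule F C, symp y y = 0 := by
    rintro ⟨α, β, ⟨a, b, c, x, y, z⟩, ⟨a', b', c', x', y', z'⟩⟩
    have hc : ∀ x y : C, nrm₂ F x y = nrm₂ F y x := fun x y =>
      QuadraticMap.polar_comm _ x y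
    simp only [symp, form, hc x' x, hc y' y, hc z' z]
    ring
  have h0 : ∀ y : FModule F C, symp 0 y = 0 := fun y =>
    LinearMap.congr_fun (map_zero (sympBilin : FModule F C →ₗ[F] FModule F C →ₗ[F] F)) y
  have e1 : x = 0 → ∀ y, (3 : F) • T x x y + symp x y • x = 0 := by
    rintro rfl y
    have : T (0 : FModule F C) 0 y = 0 := by
      refine sympBilin_injective (LinearMap.ext fun w => ?_)
      refine (symp_T 0 0 y w).trans (Eq.trans ?_ (h0 w).symm)
      obtain ⟨Φ, hΦ⟩ := q_isQuarticForm (F := F) (C := C)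
      have hq : q (0 : FModule F C) = 0 := by simp [hΦ]
      simp only [linearize₄, zero_add, hq]
      ring
    simp [this]
  have e2 : (∀ y, (3 : F) • T x x y + symp x y • x = 0) → T x x x = 0 := fun h => by
    have := h x
    rw [hself, zero_smul, add_zero] at this
    exact (smul_eq_zero.1 this).resolve_left h3
  have e3 : T x x x = 0 → q x = 0 := fun h => by
    rw [← q_isQuarticForm.linearize₄_self x, ← symp_T, h, h0]
  by_cases p0 : x = 0
  · have p1 := e1 p0
    have p2 := e2 p1
    have hr : rank x = 0 := if_pos p0
    rw [hr]
    exact ⟨by simp [e3 p2], by simp [e3 p2], iff_of_true (by simp) p2, iff_of_true (by simp) p1,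
      iff_of_true rfl p0⟩
  by_cases p1 : ∀ y, (3 : F) • T x x y + symp x y • x = 0
  · have p2 := e2 p1
    have hr : rank x = 1 := by rw [rank, if_neg p0, if_pos p1]
    rw [hr]
    exact ⟨by simp [e3 p2], by simp [e3 p2], iff_of_true (by simp) p2, iff_of_true (by simp) p1,
      iff_of_false (by simp) p0⟩
  by_cases p2 : T x x x = 0
  · have hr : rank x = 2 := by rw [rank, if_neg p0, if_neg p1, if_pos p2]
    rw [hr]
    exact ⟨by simp [e3 p2], by simp [e3 p2], iff_of_true (by simp) p2, iff_of_false (by simp) p1,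
      iff_of_false (by simp) p0⟩
  by_cases p3 : q x = 0
  · have hr : rank x = 3 := by rw [rank, if_neg p0, if_neg p1, if_neg p2, if_pos p3]
    rw [hr]
    exact ⟨by simp [p3], by simp [p3], iff_of_false (by simp) p2, iff_of_false (by simp) p1,
      iff_of_false (by simp) p0⟩
  · have hr : rank x = 4 := by rw [rank, if_neg p0, if_neg p1, if_neg p2, if_neg p3]
    rw [hr]
    exact ⟨by simp [p3], by simp [p3], iff_of_false (by simp) p2, iff_of_false (by simp) p1,
      iff_of_false (by simp) p0⟩

/-- The subsets of `M(J)` which occur in the classification: the elements of rank `1`, `2`, `3`,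
and the elements of rank `4` and norm `k`, for each `k ≠ 0`. -/
def stratum [NeZero (2 : F)] [Module.Finite F C] : Fin 3 ⊕ {k : F // k ≠ 0} → Set (FModule F C)
  | Sum.inl i => {x | rank x = i.val + 1}
  | Sum.inr k => {x | rank x = 4 ∧ q x = k.val}

/-- The classification of the orbits of `G(M)` in `M = M(H₃(C))`. -/
def OrbitClassification (F C : Type*) [Field F] [NeZero (2 : F)] [NonAssocRing C] [Module F C]
    [IsScalarTower F C C] [SMulCommClass F C C] [CompositionAlgebra F C] [Module.Finite F C] :
    Prop :=
  -- the norm `q` is a `G`-invariant quartic form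
  (IsQuarticForm (q : FModule F C → F) ∧ ∀ g ∈ G F C, ∀ x, q (g x) = q x) ∧
  -- each of the sets is a single orbit; in particular it is non-empty
  (∀ i, ∃ x : FModule F C, MulAction.orbit (G F C) x = stratum i) ∧
  -- the orbits are distinct from each other and from `{0}`
  (Function.Injective (stratum : _ → Set (FModule F C)) ∧
    ∀ i, (stratum i : Set (FModule F C)) ≠ {0}) ∧
  -- together with `{0}` they exhaust the module
  {0} ∪ ⋃ i, stratum i = (Set.univ : Set (FModule F C))

end Module

end Freudenthal

/-! The strata are `G`-stable and pairwise disjoint for formal reasons: an element of `G` preserves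
`q` and the skew form, hence the polarization of `q`, hence `T` (`T_map`), hence the rank
(`rank_map`). It therefore suffices to move every non-zero vector to one of the vectors (1, 0, 0,
0), (1, 0, diag(1,0,0), 0), (1, 0, diag(1,1,k), 0) and to compute their invariants. Their ranks are
1, 2, then 3 for k = 0 and 4 with norm -8k for k ≠ 0, so distinct representatives lie in distinct
strata and each stratum is one orbit.

The reduction uses only a few elements of `G`: the duality exchanging the two halves of M, the
cyclic rotation of Hermitian matrices, the unipotents attached to multiples of the idempotent e₁ =
diag(1,0,0), a one-parameter torus, and the transvections A ↦ E A E*. They make α non-zero.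
Transvections diagonalize B, unipotents then clear it against the pivot α, and transvections
diagonalize A while keeping B = 0 (`exists_sameOrbit_diagonal`). A combination of unipotents kills
β, which takes division by 2 (`exists_sameOrbit_snd_eq_zero`), and the torus scales α to 1.

Normalizing the diagonal matrix A to diag(1,0,0) or diag(1,1,k) is where C matters: the norm of C
must represent every element of F (`Congruent.diagonal_one_mul`). This holds for the split algebras,
and for C = F exactly when every element is a square. Everything else rests on identities valid in
any composition algebra. -/

namespace Freudenthal

/-! ### Identities in composition algebras, from linearizing n(xy) = n(x)n(y) and non-degeneracy -/

section CompositionIdentities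

variable {F C : Type*} [Field F] [NonAssocRing C] [Module F C]
  [IsScalarTower F C C] [SMulCommClass F C C] [CompositionAlgebra F C]

theorem nrm_add (x y : C) : nrm F (x + y) = nrm F x + nrm F y + nrm₂ F x y := by
  simp only [nrm, nrm₂, QuadraticMap.polarBilin_apply_apply, QuadraticMap.polar]; ring

theorem nrm_smul (r : F) (x : C) : nrm F (r • x) = r * r * nrm F x := by
  simp only [nrm, QuadraticMap.map_smul, smul_eq_mul]

theorem nrm_neg (x : C) : nrm F (-x) = nrm F x := QuadraticMap.map_neg _ _

@[simp] theorem nrm_zero : nrm F (0 : C) = 0 := QuadraticMap.map_zero _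

theorem nrm_mul (x y : C) : nrm F (x * y) = nrm F x * nrm F y :=
  CompositionAlgebra.normForm_mul x y

theorem nrm₂_comm (x y : C) : nrm₂ F x y = nrm₂ F y x := QuadraticMap.polar_comm _ x y

theorem nrm₂_self (x : C) : nrm₂ F x x = 2 * nrm F x := by
  simp only [nrm, nrm₂, QuadraticMap.polarBilin_apply_apply, QuadraticMap.polar_self,
    nsmul_eq_mul, Nat.cast_ofNat]

theorem nrm₂_ext {x y : C} (h : ∀ z, nrm₂ F x z = nrm₂ F y z) : x = y := by
  rw [← sub_eq_zero]
  refine CompositionAlgebra.polar_nondegenerate (F := F) _ fun z => ?_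
  change nrm₂ F (x - y) z = 0
  rw [map_sub, LinearMap.sub_apply, h, sub_self]

theorem exists_nrm₂_ne_zero {x : C} (hx : x ≠ 0) : ∃ u, nrm₂ F x u ≠ 0 := by
  by_contra! h
  exact hx (nrm₂_ext (F := F) fun z => by simp [h])

theorem nrm₂_mul_left (x y z : C) : nrm₂ F (x * y) (x * z) = nrm F x * nrm₂ F y z := by
  have h := nrm_mul (F := F) x (y + z)
  rw [mul_add, nrm_add, nrm_add, nrm_mul, nrm_mul] at h
  linear_combination h

theorem nrm₂_mul_right (x y z : C) : nrm₂ F (y * x) (z * x) = nrm₂ F y z * nrm F x := by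
  have h := nrm_mul (F := F) (y + z) x
  rw [add_mul, nrm_add, nrm_add, nrm_mul, nrm_mul] at h
  linear_combination h

theorem nrm₂_exchange (x y z w : C) :
    nrm₂ F (x * y) (w * z) + nrm₂ F (w * y) (x * z) = nrm₂ F x w * nrm₂ F y z := by
  have h := nrm₂_mul_left (F := F) (x + w) y z
  simp only [add_mul, map_add, LinearMap.add_apply, nrm_add, nrm₂_mul_left] at h
  linear_combination h

theorem tr_apply (x : C) : tr F x = nrm₂ F x 1 := rfl

theorem conj_apply (x : C) : conj F x = tr F x • (1 : C) - x := rfl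

theorem nrm₂_mul_adjoint_left (x y z : C) : nrm₂ F (x * y) z = nrm₂ F y (conj F x * z) := by
  have h := nrm₂_exchange (F := F) x y z 1
  simp only [one_mul] at h
  simp only [conj_apply, sub_mul, smul_mul_assoc, one_mul, map_sub, map_smul, smul_eq_mul, tr_apply]
  linear_combination h

theorem nrm₂_mul_adjoint_right (x y z : C) : nrm₂ F (x * y) z = nrm₂ F x (z * conj F y) := by
  have h := nrm₂_exchange (F := F) x y 1 z
  simp only [mul_one] at h
  simp only [conj_apply, mul_sub, mul_smul_comm, mul_one, map_sub, map_smul, smul_eq_mul, tr_apply]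
  rw [nrm₂_comm x (z * y)]
  linear_combination h

theorem tr_mul (x y : C) : tr F (x * y) = nrm₂ F x (conj F y) := by
  rw [tr_apply, nrm₂_mul_adjoint_right, one_mul]

/-- Together with its two companions, this identifies the gradients of tr((xy)z) in x, y, z as z̄ȳ,
x̄z̄, ȳx̄. These are the quadratic off-diagonal terms of `sharp`, which is the gradient of `N`. -/
theorem nrm₂_conj_mul_conj₁ (x y z : C) :
    nrm₂ F (conj F z * conj F y) x = tr F (x * y * z) := by
  rw [tr_mul, nrm₂_mul_adjoint_right x, nrm₂_comm]

theorem nrm₂_conj_mul_conj₂ (x y z : C) :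
    nrm₂ F (conj F x * conj F z) y = tr F (x * y * z) := by
  rw [tr_mul, nrm₂_mul_adjoint_left x, nrm₂_comm]

variable [Nontrivial C]

/-- Multiplicativity gives n(1)² = n(1). If n(1) were 0, then n would vanish identically, and
non-degeneracy would force 1 = 0. -/
theorem nrm_one : nrm F (1 : C) = 1 := by
  have h := nrm_mul (F := F) (1 : C) 1
  rw [mul_one] at h
  refine (mul_eq_left₀ fun h0 => one_ne_zero (α := C) ?_).1 h.symm
  have hn : ∀ x : C, nrm F x = 0 := fun x => by rw [← one_mul x, nrm_mul, h0, zero_mul]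
  refine nrm₂_ext (F := F) fun z => ?_
  have := nrm_add (F := F) 1 z
  simp only [hn] at this
  simpa using this.symm

theorem tr_one : tr F (1 : C) = 2 := by rw [tr_apply, nrm₂_self, nrm_one, mul_one]

@[simp] theorem conj_conj (x : C) : conj F (conj F x) = x := by
  rw [conj_apply, conj_apply, map_sub, map_smul, tr_one, smul_eq_mul]
  module

theorem nrm_conj (x : C) : nrm F (conj F x) = nrm F x := by
  rw [conj_apply, sub_eq_add_neg, nrm_add, nrm_smul, nrm_neg, nrm_one, map_neg, map_smul,
    LinearMap.smul_apply, nrm₂_comm, ← tr_apply, smul_eq_mul]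
  ring

theorem nrm₂_conj (x y : C) : nrm₂ F (conj F x) (conj F y) = nrm₂ F x y := by
  have h := nrm_conj (F := F) (x + y)
  rw [map_add, nrm_add, nrm_add, nrm_conj, nrm_conj] at h
  linear_combination h

theorem nrm₂_conj_comm (x y : C) : nrm₂ F (conj F x) y = nrm₂ F x (conj F y) := by
  rw [← nrm₂_conj, conj_conj]

theorem conj_mul (x y : C) : conj F (x * y) = conj F y * conj F x :=
  nrm₂_ext (F := F) fun z => by
    rw [nrm₂_conj_comm, nrm₂_mul_adjoint_left x, nrm₂_mul_adjoint_left (conj F y), conj_conj,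
      nrm₂_comm _ (y * z), nrm₂_mul_adjoint_right y z]

theorem conj_mul_mul (x y : C) : conj F x * (x * y) = nrm F x • y :=
  nrm₂_ext (F := F) fun z => by
    rw [nrm₂_mul_adjoint_left, conj_conj, nrm₂_mul_left, map_smul, LinearMap.smul_apply, smul_eq_mul]

theorem mul_conj_mul (x y : C) : x * (conj F x * y) = nrm F x • y := by
  simpa only [conj_conj, nrm_conj] using conj_mul_mul (F := F) (conj F x) y

theorem mul_mul_conj (x y : C) : (y * x) * conj F x = nrm F x • y :=
  nrm₂_ext (F := F) fun z => by
    rw [nrm₂_mul_adjoint_right, conj_conj, nrm₂_mul_right, map_smul, LinearMap.smul_apply,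
      smul_eq_mul, mul_comm]

theorem mul_conj_mul_self (x y : C) : (y * conj F x) * x = nrm F x • y := by
  simpa only [conj_conj, nrm_conj] using mul_mul_conj (F := F) (conj F x) y

theorem conj_mul_mul_add (x y z : C) :
    conj F x * (y * z) + conj F y * (x * z) = nrm₂ F x y • z := by
  have h := conj_mul_mul (F := F) (x + y) z
  simp only [map_add, add_mul, mul_add, conj_mul_mul, nrm_add, add_smul] at h
  rw [← sub_eq_zero] at h ⊢
  rw [← h]
  abel

theorem mul_mul_conj_add (x y z : C) :
    (z * x) * conj F y + (z * y) * conj F x = nrm₂ F x y • z := by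
  have h := mul_mul_conj (F := F) (x + y) z
  simp only [map_add, add_mul, mul_add, mul_mul_conj, nrm_add, add_smul] at h
  rw [← sub_eq_zero] at h ⊢
  rw [← h]
  abel

theorem nrm₂_conj_mul_conj₃ (x y z : C) :
    nrm₂ F (conj F y * conj F x) z = tr F (x * y * z) := by
  rw [tr_mul, ← conj_mul, nrm₂_conj_comm]

/-- The same element z̄ȳ is the gradient of tr((xy)z) in its first factor x and of tr((yz)x) in its
last factor x. -/
theorem tr_cyclic (x y z : C) : tr F (x * y * z) = tr F (y * z * x) := by
  rw [← nrm₂_conj_mul_conj₁ x y z, ← nrm₂_conj_mul_conj₃ y z x]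

end CompositionIdentities

/-! ### Elements of the group `G(M)` -/

section GroupElements

variable {F C : Type*} [Field F] [NonAssocRing C] [Module F C]
  [IsScalarTower F C C] [SMulCommClass F C C] [CompositionAlgebra F C]

open Herm₃

/-- Two elements of `M(J)` in the same orbit of `G(M)`. -/
def SameOrbit (v w : FModule F C) : Prop := ∃ g ∈ G F C, g v = w

theorem SameOrbit.refl (v : FModule F C) : SameOrbit v v := ⟨1, one_mem _, rfl⟩

theorem SameOrbit.trans {u v w : FModule F C} : SameOrbit u v → SameOrbit v w → SameOrbit u w := by
  rintro ⟨g, hg, rfl⟩ ⟨h, hh, rfl⟩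
  exact ⟨h * g, mul_mem hh hg, rfl⟩

theorem SameOrbit.symm {v w : FModule F C} : SameOrbit v w → SameOrbit w v := by
  rintro ⟨g, hg, rfl⟩
  exact ⟨g⁻¹, inv_mem hg, g.symm_apply_apply v⟩

theorem form_comm (A B : Herm₃ F C) : form A B = form B A := by
  obtain ⟨a, b, c, x, y, z⟩ := A
  obtain ⟨a', b', c', x', y', z'⟩ := B
  simp only [form, nrm₂_comm x, nrm₂_comm y, nrm₂_comm z]
  ring

theorem form_neg_left (A B : Herm₃ F C) : form (-A) B = -form A B := by
  obtain ⟨a, b, c, x, y, z⟩ := A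
  obtain ⟨a', b', c', x', y', z'⟩ := B
  simp only [form, map_neg, LinearMap.neg_apply]
  ring

theorem sharp_neg (A : Herm₃ F C) : sharp (-A) = sharp A := by
  obtain ⟨a, b, c, x, y, z⟩ := A
  simp [sharp, nrm_neg]

theorem N_neg (A : Herm₃ F C) : N (-A) = -N A := by
  obtain ⟨a, b, c, x, y, z⟩ := A
  simp [N, nrm_neg]
  ring

/-- Exchanging the two halves of M lets every move acting on one copy of J be transferred to the
other. -/
theorem sameOrbit_dual (α β : F) (A B : Herm₃ F C) : SameOrbit (α, β, A, B) (-β, α, -B, A) := by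
  refine ⟨
    { toFun := fun v => (-v.2.1, v.1, -v.2.2.2, v.2.2.1)
      invFun := fun v => (v.2.1, -v.1, v.2.2.2, -v.2.2.1)
      map_add' := fun v w => by simp; exact ⟨by ring, by abel⟩
      map_smul' := fun r v => by simp
      left_inv := fun v => by simp
      right_inv := fun v => by simp }, ⟨?_, ?_⟩, rfl⟩
  · rintro ⟨α, β, A, B⟩ ⟨γ, δ, D, E⟩
    simp only [LinearEquiv.coe_mk, LinearMap.coe_mk, AddHom.coe_mk, symp, form_neg_left]
    rw [form_comm A, form_neg_left, form_comm E]
    ring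
  · rintro ⟨α, β, A, B⟩
    simp only [LinearEquiv.coe_mk, LinearMap.coe_mk, AddHom.coe_mk, q, form_neg_left, sharp_neg,
      N_neg, form_comm B, form_comm (sharp B)]
    ring

variable [Nontrivial C]

theorem sameOrbit_rotate (α β a b c a' b' c' : F) (x y z x' y' z' : C) :
    SameOrbit (α, β, (a, b, c, x, y, z), (a', b', c', x', y', z'))
      (α, β, (b, c, a, y, z, x), (b', c', a', y', z', x')) := by
  refine ⟨
    { toFun := fun (α, β, (a, b, c, x, y, z), (a', b', c', x', y', z')) =>
        (α, β, (b, c, a, y, z, x), (b', c', a', y', z', x'))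
      invFun := fun (α, β, (b, c, a, y, z, x), (b', c', a', y', z', x')) =>
        (α, β, (a, b, c, x, y, z), (a', b', c', x', y', z'))
      map_add' := fun _ _ => rfl
      map_smul' := fun _ _ => rfl
      left_inv := fun _ => rfl
      right_inv := fun _ => rfl }, ⟨?_, ?_⟩, rfl⟩
  · rintro ⟨α, β, ⟨a, b, c, x, y, z⟩, ⟨a', b', c', x', y', z'⟩⟩
      ⟨α₁, β₁, ⟨a₁, b₁, c₁, x₁, y₁, z₁⟩, ⟨a₁', b₁', c₁', x₁', y₁', z₁'⟩⟩
    simp only [LinearEquiv.coe_mk, LinearMap.coe_mk, AddHom.coe_mk, symp, form]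
    ring
  · rintro ⟨α, β, ⟨a, b, c, x, y, z⟩, ⟨a', b', c', x', y', z'⟩⟩
    simp only [LinearEquiv.coe_mk, LinearMap.coe_mk, AddHom.coe_mk, q, form, sharp, N,
      ← tr_cyclic x, ← tr_cyclic x']
    ring

/-- All mixed trilinear pairings are brought to traces of products in the fixed order x, y, z, so
that invariance of `q` under the unipotents and the torus becomes a polynomial identity in common
atoms. -/
theorem q_apply (α β a b c a' b' c' : F) (x y z x' y' z' : C) :
    q ((α, β, (a, b, c, x, y, z), (a', b', c', x', y', z')) : FModule F C) =
      8 * ((b * c - nrm F x) * (b' * c' - nrm F x') + (a * c - nrm F y) * (a' * c' - nrm F y')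
        + (a * b - nrm F z) * (a' * b' - nrm F z')
        + (nrm₂ F (conj F z * conj F y) (conj F z' * conj F y') - a' * tr F (x' * y * z)
            - a * tr F (x * y' * z') + a * a' * nrm₂ F x x')
        + (nrm₂ F (conj F x * conj F z) (conj F x' * conj F z') - b' * tr F (x * y' * z)
            - b * tr F (x' * y * z') + b * b' * nrm₂ F y y')
        + (nrm₂ F (conj F y * conj F x) (conj F y' * conj F x') - c' * tr F (x * y * z')
            - c * tr F (x' * y' * z) + c * c' * nrm₂ F z z'))
      - 8 * α * (a * b * c - a * nrm F x - b * nrm F y - c * nrm F z + tr F (x * y * z))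
      - 8 * β * (a' * b' * c' - a' * nrm F x' - b' * nrm F y' - c' * nrm F z'
          + tr F (x' * y' * z'))
      - 2 * (a * a' + b * b' + c * c' + nrm₂ F x x' + nrm₂ F y y' + nrm₂ F z z' - α * β) ^ 2 := by
  simp only [q, form, sharp, N, map_sub, map_smul, LinearMap.sub_apply, LinearMap.smul_apply,
    smul_eq_mul]
  rw [nrm₂_comm x (_ * _), nrm₂_comm y (_ * _), nrm₂_comm z (_ * _)]
  rw [nrm₂_conj_mul_conj₁ x' y z, nrm₂_conj_mul_conj₁ x y' z', nrm₂_conj_mul_conj₂ x y' z,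
    nrm₂_conj_mul_conj₂ x' y z', nrm₂_conj_mul_conj₃ x y z', nrm₂_conj_mul_conj₃ x' y' z]
  ring

/-- This is the Freudenthal unipotent of the element t e₁ of J. Since e₁ has zero sharp and zero
norm, only the terms linear in t survive. -/
theorem sameOrbit_unipotent (t α β a b c a' b' c' : F) (x y z x' y' z' : C) :
    SameOrbit (α, β, (a, b, c, x, y, z), (a', b', c', x', y', z'))
      (α + t * a', β, (a + t * β, b, c, x, y, z), (a', b' + t * c, c' + t * b, x' - t • x, y', z')) := by
  refine ⟨
    { toFun := fun (α, β, (a, b, c, x, y, z), (a', b', c', x', y', z')) =>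
        (α + t * a', β, (a + t * β, b, c, x, y, z),
          (a', b' + t * c, c' + t * b, x' - t • x, y', z'))
      invFun := fun (α, β, (a, b, c, x, y, z), (a', b', c', x', y', z')) =>
        (α - t * a', β, (a - t * β, b, c, x, y, z),
          (a', b' - t * c, c' - t * b, x' + t • x, y', z'))
      map_add' := ?_
      map_smul' := ?_
      left_inv := fun _ => by simp
      right_inv := fun _ => by simp }, ⟨?_, ?_⟩, rfl⟩
  · rintro ⟨α, β, ⟨a, b, c, x, y, z⟩, ⟨a', b', c', x', y', z'⟩⟩
      ⟨α₁, β₁, ⟨a₁, b₁, c₁, x₁, y₁, z₁⟩, ⟨a₁', b₁', c₁', x₁', y₁', z₁'⟩⟩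
    simp only [Prod.mk_add_mk, Prod.mk.injEq, smul_add, true_and, and_true]
    refine ⟨by ring, by ring, by ring, by ring, by abel⟩
  · rintro r ⟨α, β, ⟨a, b, c, x, y, z⟩, ⟨a', b', c', x', y', z'⟩⟩
    simp only [Prod.smul_mk, Prod.mk.injEq, smul_eq_mul, smul_sub, smul_smul, mul_comm t r,
      RingHom.id_apply, true_and, and_true]
    refine ⟨by ring, by ring, by ring, by ring⟩
  · rintro ⟨α, β, ⟨a, b, c, x, y, z⟩, ⟨a', b', c', x', y', z'⟩⟩
      ⟨α₁, β₁, ⟨a₁, b₁, c₁, x₁, y₁, z₁⟩, ⟨a₁', b₁', c₁', x₁', y₁', z₁'⟩⟩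
    simp only [LinearEquiv.coe_mk, LinearMap.coe_mk, AddHom.coe_mk, symp, form, map_sub, map_smul,
      LinearMap.sub_apply, LinearMap.smul_apply, smul_eq_mul]
    ring
  · rintro ⟨α, β, ⟨a, b, c, x, y, z⟩, ⟨a', b', c', x', y', z'⟩⟩
    simp only [LinearEquiv.coe_mk, LinearMap.coe_mk, AddHom.coe_mk, q_apply, sub_eq_add_neg x',
      nrm_add, nrm_neg, nrm_smul, map_add, map_neg, map_smul, smul_eq_mul, add_mul, mul_add, neg_mul, mul_neg,
      smul_mul_assoc, mul_smul_comm, nrm₂_mul_left, nrm₂_mul_right, nrm_conj, nrm₂_conj,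
      nrm₂_self, nrm₂_comm x' x]
    ring

/-- The action on the first copy of J multiplies `N` by t⁻¹ and the contragredient action multiplies
it by t, so αN(A) and βN(B) are unchanged. -/
theorem sameOrbit_torus {t : F} (ht : t ≠ 0) (α β a b c a' b' c' : F) (x y z x' y' z' : C) :
    SameOrbit (α, β, (a, b, c, x, y, z), (a', b', c', x', y', z'))
      (t * α, t⁻¹ * β, (t * a, t⁻¹ * b, t⁻¹ * c, t⁻¹ • x, y, z),
        (t⁻¹ * a', t * b', t * c', t • x', y', z')) := by
  refine ⟨
    { toFun := fun (α, β, (a, b, c, x, y, z), (a', b', c', x', y', z')) =>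
        (t * α, t⁻¹ * β, (t * a, t⁻¹ * b, t⁻¹ * c, t⁻¹ • x, y, z),
          (t⁻¹ * a', t * b', t * c', t • x', y', z'))
      invFun := fun (α, β, (a, b, c, x, y, z), (a', b', c', x', y', z')) =>
        (t⁻¹ * α, t * β, (t⁻¹ * a, t * b, t * c, t • x, y, z),
          (t * a', t⁻¹ * b', t⁻¹ * c', t⁻¹ • x', y', z'))
      map_add' := ?_
      map_smul' := ?_
      left_inv := fun _ => by simp [ht, smul_smul]
      right_inv := fun _ => by simp [ht, smul_smul] }, ⟨?_, ?_⟩, rfl⟩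
  · rintro ⟨α, β, ⟨a, b, c, x, y, z⟩, ⟨a', b', c', x', y', z'⟩⟩
      ⟨α₁, β₁, ⟨a₁, b₁, c₁, x₁, y₁, z₁⟩, ⟨a₁', b₁', c₁', x₁', y₁', z₁'⟩⟩
    simp only [Prod.mk_add_mk, smul_add, mul_add]
  · rintro r ⟨α, β, ⟨a, b, c, x, y, z⟩, ⟨a', b', c', x', y', z'⟩⟩
    simp only [Prod.smul_mk, smul_eq_mul, smul_smul, mul_comm _ r, RingHom.id_apply,
      mul_left_comm _ r]
  · rintro ⟨α, β, ⟨a, b, c, x, y, z⟩, ⟨a', b', c', x', y', z'⟩⟩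
      ⟨α₁, β₁, ⟨a₁, b₁, c₁, x₁, y₁, z₁⟩, ⟨a₁', b₁', c₁', x₁', y₁', z₁'⟩⟩
    simp only [LinearEquiv.coe_mk, LinearMap.coe_mk, AddHom.coe_mk, symp, form, map_smul,
      LinearMap.smul_apply, smul_eq_mul]
    field_simp
  · rintro ⟨α, β, ⟨a, b, c, x, y, z⟩, ⟨a', b', c', x', y', z'⟩⟩
    simp only [LinearEquiv.coe_mk, LinearMap.coe_mk, AddHom.coe_mk, q_apply, nrm_smul, map_smul,
      LinearMap.smul_apply, smul_eq_mul, smul_mul_assoc, mul_smul_comm]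
    field_simp

end GroupElements

/-! ### Transvections as isometries of the cubic norm -/

section Transvections

variable {F C : Type*} [Field F] [NonAssocRing C] [Module F C]
  [IsScalarTower F C C] [SMulCommClass F C C] [CompositionAlgebra F C]

namespace Herm₃

/-- The map `A ↦ E A E*` for the elementary matrix `E = 1 + u E₁₂`. -/
def transvect (u : C) : Herm₃ F C → Herm₃ F C
  | (a, b, c, x, y, z) =>
    (a + nrm₂ F z u + b * nrm F u, b, c, x, y + conj F x * conj F u, z + b • u)

/-- The map contragredient to `transvect u` with respect to the trace form. -/
def transvectDual (u : C) : Herm₃ F C → Herm₃ F C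
  | (a, b, c, x, y, z) =>
    (a, b - nrm₂ F z u + a * nrm F u, c, x - conj F u * conj F y, y, z - a • u)

theorem form_transvect (u : C) (A B : Herm₃ F C) :
    form (transvect u A) (transvectDual u B) = form A B := by
  obtain ⟨a, b, c, x, y, z⟩ := A
  obtain ⟨a', b', c', x', y', z'⟩ := B
  simp only [form, transvect, transvectDual, map_add, map_sub, map_smul, LinearMap.add_apply,
    LinearMap.smul_apply, smul_eq_mul, nrm₂_self, nrm₂_comm x (_ * _)]
  rw [nrm₂_conj_mul_conj₁ x y' u, nrm₂_conj_mul_conj₂ x y' u, nrm₂_comm u]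
  ring

variable [Nontrivial C]

theorem N_transvect (u : C) (A : Herm₃ F C) : N (transvect u A) = N A := by
  obtain ⟨a, b, c, x, y, z⟩ := A
  simp only [N, transvect, nrm_add, nrm_mul, nrm_conj, nrm_smul, mul_add, add_mul, mul_conj_mul,
    map_add, map_smul, smul_mul_assoc, mul_smul_comm, smul_eq_mul, nrm₂_comm y (_ * _)]
  rw [nrm₂_conj_mul_conj₂ x y u, tr_mul (conj F u) z, nrm₂_conj, nrm₂_comm u,
    tr_mul (conj F u) u, nrm₂_conj, nrm₂_self]
  ring

theorem N_transvectDual (u : C) (A : Herm₃ F C) : N (transvectDual u A) = N A := by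
  obtain ⟨a, b, c, x, y, z⟩ := A
  simp only [N, transvectDual, sub_eq_add_neg, nrm_add, nrm_neg, nrm_mul, nrm_conj, nrm_smul,
    mul_add, add_mul, mul_neg, neg_mul, mul_conj_mul_self, map_neg,
    map_add, map_smul, smul_mul_assoc, mul_smul_comm, smul_eq_mul, nrm₂_comm x (_ * _)]
  rw [nrm₂_conj_mul_conj₁ x y u, tr_mul (conj F u) z, nrm₂_conj, nrm₂_comm u,
    tr_mul (conj F u) u, nrm₂_conj, nrm₂_self]
  ring

/-- Conceptually, `sharp` is the gradient of `N`, so a map preserving `N` is intertwined by it with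
the contragredient map. The verification is entrywise. -/
theorem sharp_transvect (u : C) (A : Herm₃ F C) :
    sharp (transvect u A) = transvectDual u (sharp A) := by
  obtain ⟨a, b, c, x, y, z⟩ := A
  simp only [sharp, transvect, transvectDual, Prod.mk.injEq]
  refine ⟨trivial, ?_, ?_, ?_, ?_, ?_⟩
  · simp only [nrm_add, nrm_mul, nrm_conj, map_sub, map_smul, LinearMap.sub_apply,
      LinearMap.smul_apply, smul_eq_mul, nrm₂_comm y (_ * _)]
    rw [nrm₂_conj_mul_conj₂ x y u, nrm₂_conj_mul_conj₃ x y u]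
    ring
  · simp only [nrm_add, nrm_smul, map_smul, smul_eq_mul]
    ring
  -- The only entry that mixes three independent elements of C: the linearized relation z̄(ux) +
  -- ū(zx) = n(z,u)x takes the place of associativity.
  · have h := conj_mul_mul_add (F := F) z u x
    simp only [map_add, map_sub, map_smul, conj_mul, conj_conj, mul_add, add_mul, mul_sub,
      smul_mul_assoc, mul_smul_comm, conj_mul_mul, add_smul, ← h]
    module
  · simp only [map_add, map_smul, mul_add, mul_smul_comm]
    module
  · simp only [map_add, conj_mul, conj_conj, add_mul, mul_mul_conj]
    module

theorem sharp_transvectDual (u : C) (A : Herm₃ F C) :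
    sharp (transvectDual u A) = transvect u (sharp A) := by
  obtain ⟨a, b, c, x, y, z⟩ := A
  simp only [sharp, transvect, transvectDual, Prod.mk.injEq]
  refine ⟨?_, trivial, ?_, ?_, ?_, ?_⟩
  · simp only [sub_eq_add_neg, nrm_add, nrm_neg, map_neg, nrm_mul, nrm_conj, map_add, map_smul,
      LinearMap.neg_apply, LinearMap.add_apply,
      LinearMap.smul_apply, smul_eq_mul, nrm₂_comm x (_ * _)]
    rw [nrm₂_conj_mul_conj₁ x y u, nrm₂_conj_mul_conj₃ x y u]
    ring
  · simp only [sub_eq_add_neg, nrm_add, nrm_neg, map_neg, nrm_smul, map_smul, smul_eq_mul]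
    ring
  · simp only [map_sub, map_smul, sub_mul, smul_mul_assoc]
    module
  · have h := mul_mul_conj_add (F := F) z u y
    simp only [map_sub, map_smul, conj_mul, conj_conj, mul_sub, sub_mul, smul_mul_assoc,
      mul_smul_comm, mul_mul_conj, add_smul, sub_smul, ← h]
    module
  · simp only [map_sub, conj_mul, conj_conj, mul_sub, conj_mul_mul]
    module

end Herm₃

open Herm₃

variable [Nontrivial C]

theorem sameOrbit_transvect (u : C) (α β : F) (A B : Herm₃ F C) :
    SameOrbit (α, β, A, B) (α, β, transvect u A, transvectDual u B) := by
  refine ⟨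
    { toFun := fun v => (v.1, v.2.1, transvect u v.2.2.1, transvectDual u v.2.2.2)
      invFun := fun v => (v.1, v.2.1, transvect (-u) v.2.2.1, transvectDual (-u) v.2.2.2)
      map_add' := ?_
      map_smul' := ?_
      left_inv := ?_
      right_inv := ?_ }, ⟨?_, ?_⟩, rfl⟩
  · rintro ⟨α, β, ⟨a, b, c, x, y, z⟩, ⟨a', b', c', x', y', z'⟩⟩
      ⟨α₁, β₁, ⟨a₁, b₁, c₁, x₁, y₁, z₁⟩, ⟨a₁', b₁', c₁', x₁', y₁', z₁'⟩⟩
    simp only [Prod.mk_add_mk, transvect, transvectDual, Prod.mk.injEq, map_add,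
      LinearMap.add_apply, add_mul, mul_add, add_smul, true_and]
    refine ⟨⟨by ring, by abel, by abel⟩, by ring, by abel, by abel⟩
  · rintro r ⟨α, β, ⟨a, b, c, x, y, z⟩, ⟨a', b', c', x', y', z'⟩⟩
    simp only [Prod.smul_mk, transvect, transvectDual, Prod.mk.injEq, smul_eq_mul, map_smul,
      LinearMap.smul_apply, smul_add, smul_sub, smul_smul, smul_mul_assoc, mul_smul_comm,
      RingHom.id_apply, true_and, and_true]
    exact ⟨by ring, by ring⟩
  · rintro ⟨α, β, ⟨a, b, c, x, y, z⟩, ⟨a', b', c', x', y', z'⟩⟩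
    simp [transvect, transvectDual, nrm_neg, nrm₂_self]
    exact ⟨by ring, by ring⟩
  · rintro ⟨α, β, ⟨a, b, c, x, y, z⟩, ⟨a', b', c', x', y', z'⟩⟩
    simp [transvect, transvectDual, nrm_neg, nrm₂_self]
    exact ⟨by ring, by ring⟩
  · rintro ⟨α, β, A, B⟩ ⟨γ, δ, D, E⟩
    simp only [LinearEquiv.coe_mk, LinearMap.coe_mk, AddHom.coe_mk, symp, form_transvect]
    rw [form_comm (transvectDual u B), form_transvect, form_comm B]
  · rintro ⟨α, β, A, B⟩
    simp only [LinearEquiv.coe_mk, LinearMap.coe_mk, AddHom.coe_mk, q, form_transvect,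
      sharp_transvect, sharp_transvectDual, N_transvect, N_transvectDual]
    rw [form_comm (transvectDual u _), form_transvect, form_comm (sharp B)]

end Transvections
-- Reduction of a non-zero vector to a representative
section Reduction

variable {F C : Type*} [Field F] [NonAssocRing C] [Module F C]
  [IsScalarTower F C C] [SMulCommClass F C C] [CompositionAlgebra F C] [Nontrivial C]

open Herm₃

theorem sameOrbit_transvectDual (u : C) (α β : F) (A B : Herm₃ F C) :
    SameOrbit (α, β, A, B) (α, β, transvectDual u A, transvect u B) := by
  have hneg : transvect u (-B) = -transvect u B := by
    obtain ⟨a, b, c, x, y, z⟩ := B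
    simp [transvect]
    exact ⟨by ring, by abel, by abel⟩
  refine ((sameOrbit_dual α β A B).trans (sameOrbit_transvect u (-β) α (-B) A)).trans ?_
  rw [hneg]
  exact (sameOrbit_dual _ _ _ _).symm

/-- Conjugate of the unipotent with parameter -t by duality; the sign compensates those that duality
puts on β and B. -/
theorem sameOrbit_unipotent_dual (t α β a b c a' b' c' : F) (x y z x' y' z' : C) :
    SameOrbit (α, β, (a, b, c, x, y, z), (a', b', c', x', y', z'))
      (α, β + t * a, (a, b + t * c', c + t * b', x - t • x', y, z),
        (a' + t * α, b', c', x', y', z')) := by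
  refine (sameOrbit_dual α β _ _).trans (SameOrbit.trans ?_ (sameOrbit_dual _ _ _ _).symm)
  refine Eq.subst (motive := SameOrbit _) ?_
    (sameOrbit_unipotent (-t) (-β) α (-a') (-b') (-c') a b c (-x') (-y') (-z') x y z)
  simp only [Prod.neg_mk, Prod.mk.injEq, true_and, and_true]
  exact ⟨by ring, by ring, by ring, by ring, by module⟩

/-- `Congruent A A'` says that `A'` is the image of `A` under the restriction to the first copy of
`J` of an element of `G(M)` respecting the decomposition of `M(J)`. -/
def Congruent (A A' : Herm₃ F C) : Prop :=
  ∃ τ : Herm₃ F C → Herm₃ F C, τ 0 = 0 ∧ ∀ α β B, SameOrbit (α, β, A, B) (α, β, A', τ B)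

namespace Congruent

omit [Nontrivial C] in
theorem refl (A : Herm₃ F C) : Congruent A A := ⟨id, rfl, fun _ _ _ => SameOrbit.refl _⟩

omit [Nontrivial C] in
theorem trans {A A' A'' : Herm₃ F C} : Congruent A A' → Congruent A' A'' → Congruent A A'' := by
  rintro ⟨τ, h0, h⟩ ⟨τ', h0', h'⟩
  exact ⟨τ' ∘ τ, by simp [h0, h0'], fun α β B => (h α β B).trans (h' α β _)⟩

theorem transvect (u : C) (a b c : F) (x y z : C) : Congruent (a, b, c, x, y, z)
    (a + nrm₂ F z u + b * nrm F u, b, c, x, y + conj F x * conj F u, z + b • u) :=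
  ⟨transvectDual u, by change transvectDual u (0, 0, 0, 0, 0, 0) = _; simp [transvectDual],
    fun _ _ _ => sameOrbit_transvect u _ _ _ _⟩

theorem transvectDual (u : C) (a b c : F) (x y z : C) : Congruent (a, b, c, x, y, z)
    (a, b - nrm₂ F z u + a * nrm F u, c, x - conj F u * conj F y, y, z - a • u) :=
  ⟨Herm₃.transvect u, by change Herm₃.transvect u (0, 0, 0, 0, 0, 0) = _; simp [Herm₃.transvect],
    fun _ _ _ => sameOrbit_transvectDual u _ _ _ _⟩

theorem rotate (a b c : F) (x y z : C) : Congruent (a, b, c, x, y, z) (b, c, a, y, z, x) :=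
  ⟨fun (a, b, c, x, y, z) => (b, c, a, y, z, x), rfl,
    fun _ _ _ => sameOrbit_rotate _ _ _ _ _ _ _ _ _ _ _ _ _ _⟩

theorem rotate₂ (a b c : F) (x y z : C) : Congruent (a, b, c, x, y, z) (c, a, b, z, x, y) :=
  (rotate a b c x y z).trans (rotate b c a y z x)

/-- Completing the square with a or b as pivot. If both vanish, a transvection by some u with n(z,u)
≠ 0 first creates a pivot. -/
theorem exists_diagonal_of_block (a b c : F) (z : C) :
    ∃ a' b', Congruent (a, b, c, 0, 0, z) (a', b', c, 0, 0, 0) := by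
  have key (a b : F) (z : C) (ha : a ≠ 0) :
      ∃ a' b', Congruent (a, b, c, 0, 0, z) (a', b', c, 0, 0, 0) := by
    have h := transvectDual (a⁻¹ • z) a b c 0 0 z
    rw [smul_inv_smul₀ ha, sub_self, map_zero, mul_zero, sub_zero] at h
    exact ⟨_, _, h⟩
  by_cases hz : z = 0
  · exact ⟨a, b, hz ▸ refl _⟩
  by_cases ha : a = 0
  · by_cases hb : b = 0
    · subst ha hb
      obtain ⟨u, hu⟩ := exists_nrm₂_ne_zero (F := F) hz
      have h := transvect u 0 0 c 0 0 z
      simp only [zero_add, zero_mul, add_zero, map_zero, zero_smul] at h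
      obtain ⟨a', b', h'⟩ := key _ 0 z hu
      exact ⟨a', b', h.trans h'⟩
    · have h := transvect (-(b⁻¹ • z)) a b c 0 0 z
      rw [smul_neg, smul_inv_smul₀ hb, add_neg_cancel, map_zero, zero_mul, zero_add] at h
      exact ⟨_, _, h⟩
  · exact key a b z ha

theorem exists_diagonal_of_ne_zero (a b c : F) (x y z : C) (ha : a ≠ 0) :
    ∃ a' b' c', Congruent (a, b, c, x, y, z) (a', b', c', 0, 0, 0) := by
  have h₁ := transvectDual (a⁻¹ • z) a b c x y z
  rw [smul_inv_smul₀ ha, sub_self] at h₁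
  set b₁ := b - nrm₂ F z (a⁻¹ • z) + a * nrm F (a⁻¹ • z)
  set x₁ := x - conj F (a⁻¹ • z) * conj F y
  -- In this rotated position the pivot a is the second diagonal entry and y the last off-diagonal
  -- one. The already cleared entry sits in the x-slot, so x₁ is not disturbed.
  have h₂ := transvect (-(a⁻¹ • y)) c a b₁ 0 x₁ y
  rw [smul_neg, smul_inv_smul₀ ha, add_neg_cancel, map_zero, zero_mul, add_zero] at h₂
  have h₃ := (h₁.trans (rotate₂ _ _ _ _ _ _)).trans (h₂.trans (rotate₂ _ _ _ _ _ _))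
  obtain ⟨a', b', h₄⟩ := exists_diagonal_of_block b₁
    (c + nrm₂ F y (-(a⁻¹ • y)) + a * nrm F (-(a⁻¹ • y))) a x₁
  exact ⟨_, _, _, h₃.trans h₄⟩

/-- A non-zero diagonal entry serves as pivot after rotation. With zero diagonal, a transvection
against a non-zero off-diagonal entry z produces the pivot n(z,u). -/
theorem exists_diagonal (A : Herm₃ F C) : ∃ a b c, Congruent A (a, b, c, 0, 0, 0) := by
  have key (x y z : C) (hz : z ≠ 0) :
      ∃ a' b' c', Congruent ((0, 0, 0, x, y, z) : Herm₃ F C) (a', b', c', 0, 0, 0) := by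
    obtain ⟨u, hu⟩ := exists_nrm₂_ne_zero (F := F) hz
    have h := transvect u (0 : F) 0 0 x y z
    rw [zero_add, zero_mul, add_zero] at h
    obtain ⟨a', b', c', h'⟩ := exists_diagonal_of_ne_zero _ 0 0 x (y + conj F x * conj F u)
      (z + (0 : F) • u) hu
    exact ⟨_, _, _, h.trans h'⟩
  obtain ⟨a, b, c, x, y, z⟩ := A
  by_cases ha : a = 0
  · by_cases hb : b = 0
    · by_cases hc : c = 0
      · subst ha hb hc
        by_cases hz : z = 0
        · by_cases hx : x = 0
          · by_cases hy : y = 0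
            · exact ⟨0, 0, 0, by rw [hx, hy, hz]; exact refl _⟩
            · obtain ⟨a', b', c', h⟩ := key z x y hy
              exact ⟨_, _, _, (rotate₂ _ _ _ _ _ _).trans h⟩
          · obtain ⟨a', b', c', h⟩ := key y z x hx
            exact ⟨_, _, _, (rotate _ _ _ _ _ _).trans h⟩
        · exact key x y z hz
      · obtain ⟨a', b', c', h⟩ := exists_diagonal_of_ne_zero c a b z x y hc
        exact ⟨_, _, _, (rotate₂ _ _ _ _ _ _).trans h⟩
    · obtain ⟨a', b', c', h⟩ := exists_diagonal_of_ne_zero b c a y z x hb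
      exact ⟨_, _, _, (rotate _ _ _ _ _ _).trans h⟩
  · exact exists_diagonal_of_ne_zero a b c x y z ha

omit [Nontrivial C] in
theorem eq_zero {A : Herm₃ F C} (h : Congruent A 0) : A = 0 := by
  obtain ⟨τ, h0, h⟩ := h
  obtain ⟨g, -, hg⟩ := h 0 0 0
  rw [h0] at hg
  have h' : ((0, 0, A, 0) : FModule F C) = 0 := g.map_eq_zero_iff.1 hg
  exact congrArg (fun v : FModule F C => v.2.2.1) h'

/-- A non-zero element is congruent to a diagonal one with non-zero first entry. -/
theorem exists_diagonal_ne_zero {A : Herm₃ F C} (hA : A ≠ 0) :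
    ∃ a b c, a ≠ 0 ∧ Congruent A (a, b, c, 0, 0, 0) := by
  obtain ⟨a, b, c, h⟩ := exists_diagonal A
  by_cases ha : a = 0
  · by_cases hb : b = 0
    · refine ⟨c, a, b, fun hc => hA ?_, h.trans (rotate₂ _ _ _ _ _ _)⟩
      subst ha hb hc
      exact h.eq_zero
    · exact ⟨b, c, a, hb, h.trans (rotate _ _ _ _ _ _)⟩
  · exact ⟨a, b, c, ha, h⟩

theorem diagonal_one_mul (hn : Function.Surjective (nrm F : C → F)) {b : F} (hb : b ≠ 0)
    (a c : F) :
    Congruent ((a, b, c, 0, 0, 0) : Herm₃ F C) (1, a * b, c, 0, 0, 0) := by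
  -- Chosen so that a + b n(u) = 1. The second transvection clears the off-diagonal entry b u just
  -- created, and the other diagonal entry becomes b - b² n(u) = ab.
  obtain ⟨u, hu⟩ := hn ((1 - a) / b)
  have h := (transvect u a b c 0 0 0).trans (transvectDual (b • u) _ _ _ _ _ _)
  simp only [map_zero, LinearMap.zero_apply, zero_mul, add_zero, zero_add, mul_zero, hu,
    mul_div_cancel₀ _ hb, add_sub_cancel, one_smul, sub_self, one_mul, nrm₂_self, nrm_smul] at h
  convert h using 3
  field_simp
  ring

theorem exists_diagonal_one_one (hn : Function.Surjective (nrm F : C → F)) {A : Herm₃ F C}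
    (hA : A ≠ 0) :
    Congruent A (1, 0, 0, 0, 0, 0) ∨ ∃ k, Congruent A (1, 1, k, 0, 0, 0) := by
  have key (b c : F) (hc : c ≠ 0) :
      Congruent ((1, b, c, 0, 0, 0) : Herm₃ F C) (1, 1, b * c, 0, 0, 0) :=
    ((rotate _ _ _ _ _ _).trans (diagonal_one_mul hn hc b 1)).trans (rotate₂ _ _ _ _ _ _)
  obtain ⟨a, b, c, ha, h⟩ := exists_diagonal_ne_zero hA
  -- The rotation puts the non-zero entry a in the second place, where `diagonal_one_mul` needs it;
  -- the diagonal is now (1, ca, b).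
  have h := (h.trans (rotate₂ _ _ _ _ _ _)).trans (diagonal_one_mul hn ha c b)
  by_cases hb : b = 0
  · by_cases hc : c * a = 0
    · rw [hb, hc] at h
      exact Or.inl h
    · refine Or.inr ⟨_, h.trans (Congruent.trans ?_ (key 0 (c * a) hc))⟩
      rw [hb]
      -- For d = ca, pass from (1, d, 0) through (0, 1, d) to (1, 0, d), since `key` requires a
      -- non-zero last entry.
      refine (rotate₂ _ _ _ _ _ _).trans ?_
      simpa using diagonal_one_mul hn (one_ne_zero (α := F)) 0 (c * a)
  · exact Or.inr ⟨_, h.trans (key _ b hb)⟩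

end Congruent

omit [Nontrivial C] in
theorem sameOrbit_dual_symm (α β : F) (A B : Herm₃ F C) :
    SameOrbit (α, β, A, B) (β, -α, B, -A) := by
  have h := (sameOrbit_dual β (-α) B (-A)).symm
  rwa [neg_neg, neg_neg] at h

theorem exists_sameOrbit_fst_ne_zero {v : FModule F C} (hv : v ≠ 0) :
    ∃ w : FModule F C, w.1 ≠ 0 ∧ SameOrbit v w := by
  have key (A B : Herm₃ F C) (hA : A ≠ 0) :
      ∃ w : FModule F C, w.1 ≠ 0 ∧ SameOrbit (0, 0, A, B) w := by
    obtain ⟨a, b, c, ha, τ, -, h⟩ := Congruent.exists_diagonal_ne_zero hA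
    -- Duality moves the diagonal matrix to the second copy of J, and the unipotent with t = 1 adds
    -- its first entry a ≠ 0 to the first coordinate.
    have h₁ := ((h 0 0 B).trans (sameOrbit_dual _ _ _ _)).trans
      (sameOrbit_unipotent 1 _ _ _ _ _ _ _ _ _ _ _ _ _ _)
    refine ⟨_, ?_, h₁⟩
    simpa using ha
  obtain ⟨α, β, A, B⟩ := v
  by_cases hα : α = 0
  · by_cases hβ : β = 0
    · subst hα hβ
      by_cases hA : A = 0
      · have hB : -B ≠ 0 := fun hB => hv (by rw [neg_eq_zero.1 hB, hA]; rfl)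
        obtain ⟨w, hw, h⟩ := key (-B) A hB
        refine ⟨w, hw, (sameOrbit_dual _ _ _ _).trans ?_⟩
        rwa [neg_zero]
      · exact key A B hA
    · exact ⟨_, neg_ne_zero.2 hβ, sameOrbit_dual _ _ _ _⟩
  · exact ⟨_, hα, SameOrbit.refl _⟩

/-- A dual unipotent adds tα to the first entry of B and leaves the rest of B alone; t = -a/α kills
that entry. The built-in rotation makes three applications clear a whole diagonal. -/
theorem exists_sameOrbit_clear {α : F} (hα : α ≠ 0) (β : F) (A : Herm₃ F C) (a b c : F)
    (x y z : C) :
    ∃ β' A', SameOrbit (α, β, A, (a, b, c, x, y, z)) (α, β', A', (b, c, 0, y, z, x)) := by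
  obtain ⟨a', b', c', x', y', z'⟩ := A
  have h := (sameOrbit_unipotent_dual (-a / α) α β a' b' c' a b c x' y' z' x y z).trans
    (sameOrbit_rotate _ _ _ _ _ _ _ _ _ _ _ _ _ _)
  rw [div_mul_cancel₀ _ hα, add_neg_cancel] at h
  exact ⟨_, _, h⟩

theorem exists_sameOrbit_diagonal {v : FModule F C} (hv : v ≠ 0) :
    ∃ α β a b c : F, α ≠ 0 ∧ SameOrbit v (α, β, (a, b, c, 0, 0, 0), 0) := by
  obtain ⟨⟨α, β, A, B⟩, hα, h⟩ := exists_sameOrbit_fst_ne_zero hv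
  -- Congruence diagonalizes the first copy of J, and duality places -B there.
  obtain ⟨a, b, c, τ, -, h₁⟩ := Congruent.exists_diagonal (-B)
  have h₂ := ((h.trans (sameOrbit_dual _ _ _ _)).trans (h₁ _ _ _)).trans
    (sameOrbit_dual_symm _ _ _ _)
  rw [neg_neg, Prod.neg_mk, Prod.neg_mk, Prod.neg_mk, Prod.neg_mk, Prod.neg_mk, neg_zero] at h₂
  obtain ⟨β₁, A₁, h₃⟩ := exists_sameOrbit_clear hα β (τ A) (-a) (-b) (-c) 0 0 0
  obtain ⟨β₂, A₂, h₄⟩ := exists_sameOrbit_clear hα β₁ A₁ (-b) (-c) 0 0 0 0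
  obtain ⟨β₃, A₃, h₅⟩ := exists_sameOrbit_clear hα β₂ A₂ (-c) 0 0 0 0 0
  obtain ⟨a', b', c', τ', h0, h₆⟩ := Congruent.exists_diagonal A₃
  have h₇ := (((h₂.trans h₃).trans h₄).trans h₅).trans (h₆ α β₃ 0)
  rw [h0] at h₇
  exact ⟨α, β₃, a', b', c', hα, h₇⟩

/-- A unipotent changes a to a + tβ at the cost of B = diag(0, tc, tb). Clearing these two entries
against α subtracts tbc/α from β twice, and corrects a at second order in t. -/
theorem sameOrbit_diagonal_step {α : F} (hα : α ≠ 0) (t β a b c : F) :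
    SameOrbit ((α, β, (a, b, c, 0, 0, 0), 0) : FModule F C)
      (α, β - 2 * t * b * c / α, (c, a + t * β - t * t * b * c / α, b, 0, 0, 0), 0) := by
  have h₁ := (sameOrbit_unipotent t α β a b c 0 0 0 (0 : C) 0 0 0 0 0).trans
    (sameOrbit_rotate _ _ _ _ _ _ _ _ _ _ _ _ _ _)
  have h₂ := (sameOrbit_unipotent_dual (-(t * c) / α) α β b c (a + t * β) (t * c) (t * b) 0
    (0 : C) 0 0 0 0 0).trans (sameOrbit_rotate _ _ _ _ _ _ _ _ _ _ _ _ _ _)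
  have h₃ := sameOrbit_unipotent_dual (-(t * b) / α) α (β + -(t * c) / α * b) c
    (a + t * β + -(t * c) / α * (t * b)) b (t * b) 0 0 (0 : C) 0 0 0 0 0
  simp only [mul_zero, add_zero, zero_add, smul_zero, sub_zero, div_mul_cancel₀ _ hα,
    add_neg_cancel] at h₁ h₂ h₃
  have h := (h₁.trans h₂).trans h₃
  refine Eq.subst (motive := SameOrbit _) ?_ h
  simp only [Prod.mk.injEq, true_and, and_true]
  exact ⟨by ring, by ring, rfl⟩

theorem exists_sameOrbit_snd_eq_zero {α : F} (h2 : (2 : F) ≠ 0) (hα : α ≠ 0) (β a b c : F) :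
    ∃ a' b' c' : F, SameOrbit ((α, β, (a, b, c, 0, 0, 0), 0) : FModule F C)
      (α, 0, (a', b', c', 0, 0, 0), 0) := by
  have key (a b c : F) (hb : b ≠ 0) (hc : c ≠ 0) :
      ∃ a' b' c' : F, SameOrbit ((α, β, (a, b, c, 0, 0, 0), 0) : FModule F C)
        (α, 0, (a', b', c', 0, 0, 0), 0) := by
    -- The parameter solves β - 2tbc/α = 0.
    have h := sameOrbit_diagonal_step (C := C) hα (α * β / (2 * b * c)) β a b c
    rw [show β - 2 * (α * β / (2 * b * c)) * b * c / α = 0 by field_simp; ring] at h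
    exact ⟨_, _, _, h⟩
  by_cases hβ : β = 0
  · exact ⟨a, b, c, hβ ▸ SameOrbit.refl _⟩
  -- When bc = 0 the move preserves β and changes a to a + tβ, so a can be set to 1. At most two
  -- such moves make the last two entries non-zero, as `key` requires.
  have step (a b c : F) (hbc : b * c = 0) :
      SameOrbit ((α, β, (a, b, c, 0, 0, 0), 0) : FModule F C)
        (α, β, (c, 1, b, 0, 0, 0), 0) := by
    have h := sameOrbit_diagonal_step (C := C) hα ((1 - a) / β) β a b c
    rwa [mul_assoc, hbc, mul_assoc _ b, hbc, mul_zero, mul_zero, zero_div, sub_zero, sub_zero,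
      div_mul_cancel₀ _ hβ, add_sub_cancel] at h
  by_cases hbc : b * c = 0
  · have h₁ := step a b c hbc
    by_cases hb : b = 0
    · have h₂ := step c 1 b (by rw [hb, mul_zero])
      obtain ⟨a', b', c', h₃⟩ := key b 1 1 one_ne_zero one_ne_zero
      exact ⟨_, _, _, (h₁.trans h₂).trans h₃⟩
    · obtain ⟨a', b', c', h₃⟩ := key c 1 b one_ne_zero hb
      exact ⟨_, _, _, h₁.trans h₃⟩
  · exact key a b c (left_ne_zero_of_mul hbc) (right_ne_zero_of_mul hbc)

/-- Representatives of the non-zero orbits. -/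
theorem sameOrbit_representative (h2 : (2 : F) ≠ 0) (hn : Function.Surjective (nrm F : C → F))
    {v : FModule F C} (hv : v ≠ 0) :
    SameOrbit v (1, 0, 0, 0) ∨ SameOrbit v (1, 0, (1, 0, 0, 0, 0, 0), 0) ∨
      ∃ k, SameOrbit v (1, 0, (1, 1, k, 0, 0, 0), 0) := by
  obtain ⟨α, β, a, b, c, hα, h₁⟩ := exists_sameOrbit_diagonal hv
  obtain ⟨a', b', c', h₂⟩ := exists_sameOrbit_snd_eq_zero (C := C) h2 hα β a b c
  -- The parameter α⁻¹ scales the first coordinate to 1; β and B are already zero and stay so.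
  have h₃ := sameOrbit_torus (inv_ne_zero hα) α 0 a' b' c' 0 0 0 (0 : C) 0 0 0 0 0
  simp only [mul_zero, smul_zero, inv_mul_cancel₀ hα] at h₃
  have h := (h₁.trans h₂).trans h₃
  set A : Herm₃ F C := (α⁻¹ * a', α⁻¹⁻¹ * b', α⁻¹⁻¹ * c', 0, 0, 0)
  have apply {A' : Herm₃ F C} (hA : Congruent A A') : SameOrbit v (1, 0, A', 0) := by
    obtain ⟨τ, h0, hτ⟩ := hA
    simpa only [h0] using h.trans (hτ 1 0 0)
  by_cases hA : A = 0
  · rw [hA] at h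
    exact Or.inl h
  · rcases Congruent.exists_diagonal_one_one hn hA with hA | ⟨k, hA⟩
    · exact Or.inr (Or.inl (apply hA))
    · exact Or.inr (Or.inr ⟨k, apply hA⟩)

end Reduction
-- Invariance of the rank and the ranks of the representatives
section Rank

variable {F C : Type*} [Field F] [NonAssocRing C] [Module F C]
  [IsScalarTower F C C] [SMulCommClass F C C] [CompositionAlgebra F C]

open Herm₃

/-- Only the term -8αN(A) survives. This dictates the last entry -k/8 in the representative of norm
k. -/
theorem q_diagonal (k : F) : q ((1, 0, (1, 1, k, 0, 0, 0), 0) : FModule F C) = -8 * k := by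
  change q ((1, 0, (1, 1, k, 0, 0, 0), (0, 0, 0, 0, 0, 0)) : FModule F C) = _
  simp [q, form, sharp, N]

theorem symp_zero_left (v : FModule F C) : symp 0 v = 0 :=
  LinearMap.congr_fun (map_zero (sympBilin : FModule F C →ₗ[F] FModule F C →ₗ[F] F)) v

theorem symp_left_injective {v w : FModule F C} (h : ∀ u, symp v u = symp w u) : v = w :=
  sympBilin_injective (LinearMap.ext h)

theorem linearize₄_map {g : FModule F C ≃ₗ[F] FModule F C} (hg : g ∈ G F C)
    (x y z w : FModule F C) :
    linearize₄ q (g x) (g y) (g z) (g w) = linearize₄ q x y z w := by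
  simp only [linearize₄, ← g.map_add, hg.2]

variable [NeZero (2 : F)] [Module.Finite F C]

/-- `T` is determined by the polarization of `q` and the non-degenerate skew form, both of which g
preserves. -/
theorem T_map {g : FModule F C ≃ₗ[F] FModule F C} (hg : g ∈ G F C) (x y z : FModule F C) :
    T (g x) (g y) (g z) = g (T x y z) :=
  symp_left_injective fun u => by
    rw [← g.apply_symm_apply u, hg.1, symp_T, symp_T, linearize₄_map hg]

open Classical in
theorem rank_map {g : FModule F C ≃ₗ[F] FModule F C} (hg : g ∈ G F C) (x : FModule F C) :
    rank (g x) = rank x := by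
  refine if_congr g.map_eq_zero_iff rfl (if_congr ?_ rfl
    (if_congr ?_ rfl (if_congr (by rw [hg.2]) rfl rfl)))
  · rw [g.surjective.forall]
    refine forall_congr' fun y => ?_
    rw [T_map hg, hg.1, ← g.map_smul, ← g.map_smul, ← g.map_add]
    exact g.map_eq_zero_iff
  · rw [T_map hg]
    exact g.map_eq_zero_iff

theorem SameOrbit.rank_eq {v w : FModule F C} (h : SameOrbit v w) : rank v = rank w := by
  obtain ⟨g, hg, rfl⟩ := h
  exact (rank_map hg v).symm

omit [NeZero (2 : F)] [Module.Finite F C] in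
theorem SameOrbit.q_eq {v w : FModule F C} (h : SameOrbit v w) : q v = q w := by
  obtain ⟨g, hg, rfl⟩ := h
  exact (hg.2 v).symm

theorem T_self_eq_zero_iff (x : FModule F C) :
    T x x x = 0 ↔ ∀ w, linearize₄ q x x x w = 0 := by
  refine ⟨fun h w => by rw [← symp_T, h, symp_zero_left], fun h => symp_left_injective fun w => ?_⟩
  rw [symp_T, h, symp_zero_left]

variable [NeZero (3 : F)]

omit [NonAssocRing C] [Module F C] [IsScalarTower F C C] [SMulCommClass F C C]
  [CompositionAlgebra F C] [Module.Finite F C] in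
theorem twentyFour_ne_zero : (24 : F) ≠ 0 := by
  have h2 : (2 : F) ≠ 0 := NeZero.ne _
  have h3 : (3 : F) ≠ 0 := NeZero.ne _
  rw [show (24 : F) = 2 * 2 * 2 * 3 by norm_num]
  simp [h2, h3]

/-- Testing the defining vector equation against every w turns it into a scalar condition on the
polarization of `q`, so `T` itself need not be computed. -/
theorem rank_le_one_iff (x : FModule F C) :
    rank x ≤ 1 ↔ ∀ y w, 3 * linearize₄ q x x y w + symp x y * symp x w = 0 := by
  have key (y w : FModule F C) : symp ((3 : F) • T x x y + symp x y • x) w =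
      3 * linearize₄ q x x y w + symp x y * symp x w := by
    change sympBilin ((3 : F) • T x x y + symp x y • x) w = _
    rw [map_add, map_smul, map_smul, LinearMap.add_apply, LinearMap.smul_apply,
      LinearMap.smul_apply, smul_eq_mul, smul_eq_mul, ← symp_T]
    rfl
  rw [(rank_conditions x).2.2.2.1]
  refine forall_congr' fun y => ⟨fun h w => by rw [← key, h, symp_zero_left],
    fun h => symp_left_injective fun w => by rw [key, h, symp_zero_left]⟩

theorem rank_primitive : rank ((1, 0, 0, 0) : FModule F C) = 1 := by
  have h24 := twentyFour_ne_zero (F := F)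
  have h0 : rank ((1, 0, 0, 0) : FModule F C) ≠ 0 := by
    rw [Ne, (rank_conditions _).2.2.2.2]
    exact fun h => one_ne_zero (congrArg Prod.fst h)
  refine le_antisymm ((rank_le_one_iff _).2 ?_) (Nat.one_le_iff_ne_zero.2 h0)
  rintro ⟨α, β, A, B⟩ ⟨γ, δ, D, E⟩
  have hf (A : Herm₃ F C) : form 0 A = 0 := by
    obtain ⟨a, b, c, x, y, z⟩ := A
    change form (0, 0, 0, 0, 0, 0) _ = 0
    simp [form]
  have hs : sharp (0 : Herm₃ F C) = 0 := by
    change sharp (0, 0, 0, 0, 0, 0) = _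
    simp [sharp]
  have hN : N (0 : Herm₃ F C) = 0 := by
    change N (0, 0, 0, 0, 0, 0) = _
    simp [N]
  simp only [linearize₄, Prod.mk_add_mk, add_zero, zero_add, q, symp, hf, hs, hN]
  field_simp
  ring

theorem rank_two_representative : rank ((1, 0, (1, 0, 0, 0, 0, 0), 0) : FModule F C) = 2 := by
  have h2 : (2 : F) ≠ 0 := NeZero.ne _
  have h24 := twentyFour_ne_zero (F := F)
  refine le_antisymm ((rank_conditions _).2.2.1.2 ((T_self_eq_zero_iff _).2 ?_)) ?_
  · rintro ⟨α, β, ⟨a, b, c, x, y, z⟩, ⟨a', b', c', x', y', z'⟩⟩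
    change linearize₄ q (1, 0, (1, 0, 0, 0, 0, 0), (0, 0, 0, 0, 0, 0))
      (1, 0, (1, 0, 0, 0, 0, 0), (0, 0, 0, 0, 0, 0)) (1, 0, (1, 0, 0, 0, 0, 0), (0, 0, 0, 0, 0, 0))
      (α, β, (a, b, c, x, y, z), (a', b', c', x', y', z')) = 0
    simp only [linearize₄, Prod.mk_add_mk, add_zero, zero_add, q, form, sharp, N, map_zero,
      nrm_zero, mul_zero, sub_zero, smul_zero, map_sub, map_smul,
      LinearMap.sub_apply, LinearMap.smul_apply, smul_eq_mul]
    ring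
  · by_contra! h
    -- The test vectors e₂ and e₃ detect the monomial -8αabc of `q`: up to the factor 1/24 its
    -- polarization here is -16, while both skew products vanish.
    have h := (rank_le_one_iff _).1 (Nat.lt_succ_iff.1 h)
      (0, 0, (0, 1, 0, 0, 0, 0), (0, 0, 0, 0, 0, 0)) (0, 0, (0, 0, 1, 0, 0, 0), (0, 0, 0, 0, 0, 0))
    change 3 * linearize₄ q (1, 0, (1, 0, 0, 0, 0, 0), (0, 0, 0, 0, 0, 0))
      (1, 0, (1, 0, 0, 0, 0, 0), (0, 0, 0, 0, 0, 0)) _ _ + symp (1, 0, (1, 0, 0, 0, 0, 0),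
      (0, 0, 0, 0, 0, 0)) _ * _ = 0 at h
    simp [linearize₄, q, form, sharp, N, symp] at h
    rcases h with h | h | h
    · exact NeZero.ne _ h
    · exact h24 h
    · exact pow_ne_zero 4 h2 (by linear_combination -h)

theorem rank_three_representative : rank ((1, 0, (1, 1, 0, 0, 0, 0), 0) : FModule F C) = 3 := by
  have h2 : (2 : F) ≠ 0 := NeZero.ne _
  have h24 := twentyFour_ne_zero (F := F)
  refine le_antisymm ((rank_conditions _).2.1.2 (by rw [q_diagonal, mul_zero])) ?_
  by_contra! h
  -- The test vector e₃ supplies the missing factor of -8αabc; the polarized value is -48/24.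
  have h := (T_self_eq_zero_iff _).1 ((rank_conditions _).2.2.1.1 (Nat.lt_succ_iff.1 h))
      (0, 0, (0, 0, 1, 0, 0, 0), (0, 0, 0, 0, 0, 0))
  change linearize₄ q (1, 0, (1, 1, 0, 0, 0, 0), (0, 0, 0, 0, 0, 0))
    (1, 0, (1, 1, 0, 0, 0, 0), (0, 0, 0, 0, 0, 0)) (1, 0, (1, 1, 0, 0, 0, 0), (0, 0, 0, 0, 0, 0))
     _ = 0 at h
  simp [linearize₄, q, form, sharp, N] at h
  rcases h with h | h
  · exact h24 h
  · exact mul_ne_zero h2 h24 (by linear_combination -h)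

theorem rank_four_representative {k : F} (hk : k ≠ 0) :
    rank ((1, 0, (1, 1, k, 0, 0, 0), 0) : FModule F C) = 4 := by
  have h2 : (2 : F) ≠ 0 := NeZero.ne _
  rw [(rank_conditions _).1, q_diagonal, show (-8 : F) = -(2 * 2 * 2) by norm_num]
  simp [h2, hk]

end Rank

/-! ### From representatives to the orbit classification -/

section Classification

variable {F C : Type*} [Field F] [NonAssocRing C] [Module F C]
  [IsScalarTower F C C] [SMulCommClass F C C] [CompositionAlgebra F C]
  [NeZero (2 : F)] [NeZero (3 : F)] [Module.Finite F C]

/-- Representatives of the strata. -/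
noncomputable def representative : Fin 3 ⊕ {k : F // k ≠ 0} → FModule F C
  | Sum.inl 0 => (1, 0, 0, 0)
  | Sum.inl 1 => (1, 0, (1, 0, 0, 0, 0, 0), 0)
  | Sum.inl 2 => (1, 0, (1, 1, 0, 0, 0, 0), 0)
  | Sum.inr k => (1, 0, (1, 1, -k.val / 8, 0, 0, 0), 0)

theorem representative_mem_stratum (i : Fin 3 ⊕ {k : F // k ≠ 0}) :
    (representative i : FModule F C) ∈ (stratum i : Set (FModule F C)) := by
  have h8 : (8 : F) ≠ 0 := by
    rw [show (8 : F) = 2 ^ 3 by norm_num]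
    exact pow_ne_zero _ (NeZero.ne _)
  match i with
  | Sum.inl 0 => exact rank_primitive
  | Sum.inl 1 => exact rank_two_representative
  | Sum.inl 2 => exact rank_three_representative
  | Sum.inr k =>
    refine ⟨rank_four_representative (div_ne_zero (neg_ne_zero.2 k.2) h8), ?_⟩
    rw [representative, q_diagonal]
    field_simp

omit [NeZero (3 : F)] in
theorem stratum_eq_of_mem {v : FModule F C} {i j : Fin 3 ⊕ {k : F // k ≠ 0}}
    (hi : v ∈ (stratum i : Set (FModule F C))) (hj : v ∈ (stratum j : Set (FModule F C))) :
    i = j := by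
  match i, j with
  | Sum.inl i, Sum.inl j =>
    have h : i.val + 1 = j.val + 1 := (Eq.symm hi).trans hj
    exact congrArg _ (Fin.ext (Nat.succ_injective h))
  | Sum.inl i, Sum.inr k =>
    have h : i.val + 1 = 4 := (Eq.symm hi).trans hj.1
    omega
  | Sum.inr k, Sum.inl i =>
    have h : i.val + 1 = 4 := (Eq.symm hj).trans hi.1
    omega
  | Sum.inr k, Sum.inr l =>
    exact congrArg _ (Subtype.ext (hi.2.symm.trans hj.2))

omit [NeZero (3 : F)] in
theorem SameOrbit.mem_stratum {v w : FModule F C} (h : SameOrbit v w)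
    {i : Fin 3 ⊕ {k : F // k ≠ 0}} (hv : v ∈ (stratum i : Set (FModule F C))) :
    w ∈ (stratum i : Set (FModule F C)) := by
  match i with
  | Sum.inl i => exact h.rank_eq.symm.trans hv
  | Sum.inr k => exact ⟨h.rank_eq.symm.trans hv.1, h.q_eq.symm.trans hv.2⟩

omit [NeZero (3 : F)] [Module.Finite F C] in
theorem exists_sameOrbit_representative (hn : Function.Surjective (nrm F : C → F))
    {v : FModule F C} (hv : v ≠ 0) : ∃ i, SameOrbit v (representative i) := by
  have h2 : (2 : F) ≠ 0 := NeZero.ne _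
  have h8 : (8 : F) ≠ 0 := by
    rw [show (8 : F) = 2 ^ 3 by norm_num]
    exact pow_ne_zero _ h2
  -- An element of norm 1 cannot be zero.
  have : Nontrivial C := by
    obtain ⟨u, hu⟩ := hn 1
    exact ⟨u, 0, fun h => by simp [h] at hu⟩
  rcases sameOrbit_representative h2 hn hv with h | h | ⟨k, h⟩
  · exact ⟨Sum.inl 0, h⟩
  · exact ⟨Sum.inl 1, h⟩
  · by_cases hk : k = 0
    · subst hk
      exact ⟨Sum.inl 2, h⟩
    · refine ⟨Sum.inr ⟨-8 * k, mul_ne_zero (neg_ne_zero.2 h8) hk⟩, ?_⟩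
      rwa [representative, show -(-8 * k) / 8 = k by field_simp]

/-- The orbit classification holds for every composition algebra whose norm is surjective. -/
theorem orbitClassification_of_surjective_nrm (hn : Function.Surjective (nrm F : C → F)) :
    OrbitClassification F C := by
  have hzero (i : Fin 3 ⊕ {k : F // k ≠ 0}) : (0 : FModule F C) ∉ stratum i := by
    have h0 : rank (0 : FModule F C) = 0 := (rank_conditions 0).2.2.2.2.2 rfl
    match i with
    | Sum.inl i => exact fun h => Nat.succ_ne_zero _ ((Eq.symm h).trans h0)
    | Sum.inr k => exact fun h => four_ne_zero (h.1.symm.trans h0)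
  refine ⟨⟨q_isQuarticForm, fun g hg => hg.2⟩, fun i => ⟨representative i, ?_⟩,
    ⟨fun i j h => ?_, fun i h => hzero i (h ▸ rfl)⟩, ?_⟩
  · ext v
    constructor
    · rintro ⟨g, rfl⟩
      exact SameOrbit.mem_stratum ⟨g.1, g.2, rfl⟩ (representative_mem_stratum i)
    · intro hv
      -- The vector v lies in the orbit of some representative; stability and disjointness of the
      -- strata force it to be the one indexed by i.
      obtain ⟨j, hj⟩ := exists_sameOrbit_representative hn fun h0 : v = 0 => hzero i (h0 ▸ hv)
      obtain rfl := stratum_eq_of_mem (hj.mem_stratum hv) (representative_mem_stratum j)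
      obtain ⟨g, hg, h⟩ := hj.symm
      exact ⟨⟨g, hg⟩, h⟩
  · exact stratum_eq_of_mem (representative_mem_stratum i) (h ▸ representative_mem_stratum i)
  · refine Set.eq_univ_of_forall fun v => ?_
    by_cases hv : v = 0
    · exact Or.inl hv
    · obtain ⟨i, hi⟩ := exists_sameOrbit_representative hn hv
      exact Or.inr (Set.mem_iUnion.2 ⟨i, hi.symm.mem_stratum (representative_mem_stratum i)⟩)

end Classification

/-! ### Surjectivity of the norm in the four cases -/

section Surjectivity

variable (F : Type*) [Field F]

theorem Binarion.nrm_surjective : Function.Surjective (nrm F : Binarion F → F) :=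
  fun k => ⟨(k, 1), mul_one k⟩

theorem SplitQuaternion.nrm_surjective : Function.Surjective (nrm F : SplitQuaternion F → F) :=
  fun k => ⟨!![k, 0; 0, 1], by
    change Matrix.det (!![k, 0; 0, 1] : SplitQuaternion F) = k
    simp [Matrix.det_fin_two]⟩

theorem SplitOctonion.nrm_surjective : Function.Surjective (nrm F : SplitOctonion F → F) :=
  fun k => by
    obtain ⟨a, ha⟩ := SplitQuaternion.nrm_surjective F k
    refine ⟨((a, 0) : SplitQuaternion F × SplitQuaternion F), ?_⟩
    change Matrix.det a + Matrix.det (0 : SplitQuaternion F) = k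
    rw [show a.det = k from ha, Matrix.det_zero, add_zero]

theorem nrm_self_surjective [NeZero (2 : F)] (h : ∀ a : F, IsSquare a) :
    Function.Surjective (nrm F : F → F) := fun k => by
  obtain ⟨r, hr⟩ := h k
  exact ⟨r, hr.symm⟩

end Surjectivity
end Freudenthal

open Freudenthal in
theorem theorem3 (F : Type*) [Field F] [NeZero (2 : F)] [NeZero (3 : F)] :
    (OrbitClassification F (Binarion F) ∧
      OrbitClassification F (SplitQuaternion F) ∧
      OrbitClassification F (SplitOctonion F)) ∧
    ((∀ a : F, IsSquare a) → OrbitClassification F F) :=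
  ⟨⟨orbitClassification_of_surjective_nrm (Binarion.nrm_surjective F),
    orbitClassification_of_surjective_nrm (SplitQuaternion.nrm_surjective F),
    orbitClassification_of_surjective_nrm (SplitOctonion.nrm_surjective F)⟩,
    fun h => orbitClassification_of_surjective_nrm (nrm_self_surjective F h)⟩
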